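/- Let $k\ge 0$ and, for $i=1,\dots,k$, let $M_i$ be a smooth, Hausdorff, second countable manifold (without boundary) and $L_i$ a Dirac structure on $M_i$, that is, a smooth subbundle $L_i\subset \mathbb TM_i:=TM_i\oplus T^*M_i$ which is maximally isotropic for the pairing $\langle X+\alpha,Y+\beta\rangle=\tfrac12(\alpha(Y)+\beta(X))$ and whose smooth sections are closed under the Dorfman bracket $[\![X+\alpha,Y+\beta]\!]=[X,Y]+\mathcal L_X\beta-\iota_Yd\alpha$. For a Dirac structure $L$ on $M$ let $\mathrm{Adm}(M,L)$ be the algebra of the admissible functions, i.e. of those $f\in C^\infty(M)$ for which there is a smooth vector field $X_f$ with $X_f+df\in\Gamma(L)$; it is a Poisson algebra with the bracket $\{f,g\}=-X_f\,g$ (which does not depend on the choice of $X_f$). Let $\mathfrak g_1,\dots,\mathfrak g_k$ be finite-dimensional real Lie algebras and let $\varphi_i:\mathfrak g_i\to\mathrm{Adm}(M_i,L_i)$ be Lie algebra morphisms, with momentum maps $J_{\varphi_i}:M_i\to\mathfrak g_i^*$, $\langle J_{\varphi_i}(x),v\rangle=\varphi_i(v)(x)$. Equip $C^\infty(\mathfrak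 g_1^*\times\cdots\times\mathfrak g_k^*)$ with the product of the Kirillov–Kostant–Souriau Poisson structures, $$\{F,G\}(\xi)=\sum_{i=1}^k\big\langle \xi_i,[d_iF(\xi),d_iG(\xi)]\big\rangle ,$$ where $d_iF(\xi)\in\mathfrak g_i^{**}=\mathfrak g_i$ is the partial differential of $F$ in the $i$-th variable. Then the product $L_1\times\cdots\times L_k$ (under the canonical identification $\mathbb T(\prod_i M_i)\cong\prod_i\mathbb TM_i$) is a Dirac structure on $\prod_i M_i$, the pullback $F\mapsto F\circ(J_{\varphi_1}\times\cdots\times J_{\varphi_k})$ maps $C^\infty(\mathfrak g_1^*\times\cdots\times\mathfrak g_k^*)$ into $\mathrm{Adm}(\prod_iM_i,\prod_iL_i)$, and it is a morphism of Poisson algebras, i.e. a morphism of unital real algebras which preserves the brackets. -/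

import Mathlib

open scoped Manifold ContDiff

noncomputable section

/-! ## Poisson algebras -/

/-- A real Poisson algebra: a commutative real algebra with a Lie bracket `poissonBracket` that is a
derivation in each argument. -/
class PoissonAlgebra (A : Type*) [CommRing A] [Algebra ℝ A] where
  poissonBracket : A →ₗ[ℝ] A →ₗ[ℝ] A
  pb_self : ∀ a, poissonBracket a a = 0
  jacobi : ∀ a b c, poissonBracket a (poissonBracket b c) + poissonBracket b (poissonBracket c a) + poissonBracket c (poissonBracket a b) = 0
  leibniz : ∀ a b c, poissonBracket (b * c) a = b * poissonBracket c a + poissonBracket b a * c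

/-- A morphism of Poisson algebras: a morphism of unital real algebras that preserves brackets. -/
structure PoissonHom (A B : Type*) [CommRing A] [Algebra ℝ A] [PoissonAlgebra A]
    [CommRing B] [Algebra ℝ B] [PoissonAlgebra B] extends A →ₐ[ℝ] B where
  map_pb : ∀ a b, toFun (PoissonAlgebra.poissonBracket a b) = PoissonAlgebra.poissonBracket (toFun a) (toFun b)

/-! ## The linear (Kirillov-Kostant-Souriau) Poisson structure on a product of duals -/

section Trilinear
variable {P V W : Type*} [NormedAddCommGroup P] [NormedSpace ℝ P] [FiniteDimensional ℝ P]
  [NormedAddCommGroup V] [NormedSpace ℝ V] [FiniteDimensional ℝ V]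
  [NormedAddCommGroup W] [NormedSpace ℝ W] [FiniteDimensional ℝ W]
  {Q : Type*} [NormedAddCommGroup Q] [NormedSpace ℝ Q]

def finCLM : (V →ₗ[ℝ] Q) →ₗ[ℝ] V →L[ℝ] Q where
  toFun T := { toLinearMap := T, cont := T.continuous_of_finiteDimensional }
  map_add' _ _ := rfl
  map_smul' _ _ := rfl

def trilinCLM (T : P →ₗ[ℝ] V →ₗ[ℝ] W →ₗ[ℝ] ℝ) : P →L[ℝ] V →L[ℝ] W →L[ℝ] ℝ :=
  finCLM (finCLM ∘ₗ (LinearMap.compRight ℝ finCLM ∘ₗ T))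

variable (T : P →ₗ[ℝ] V →ₗ[ℝ] W →ₗ[ℝ] ℝ)

theorem trilinCLM_apply (ξ : P) (φ : V) (ψ : W) : trilinCLM T ξ φ ψ = T ξ φ ψ := rfl

theorem contDiff_trilin {p : Q → P} {u : Q → V} {w : Q → W} (hp : ContDiff ℝ ∞ p)
    (hu : ContDiff ℝ ∞ u) (hw : ContDiff ℝ ∞ w) :
    ContDiff ℝ ∞ (fun q => T (p q) (u q) (w q)) :=
  have h0 : ContDiff ℝ ∞ (fun q => trilinCLM T q) := ContinuousLinearMap.contDiff _
  have h : ContDiff ℝ ∞ (fun q => trilinCLM T (p q) (u q) (w q)) :=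
    (ContDiff.clm_apply (f := fun q => trilinCLM T (p q))
      (h0.comp hp) hu).clm_apply hw
  h

theorem fderiv_trilin {u : P → V} {w : P → W} {ξ : P} (hu : DifferentiableAt ℝ u ξ)
    (hw : DifferentiableAt ℝ w ξ) (η : P) :
    fderiv ℝ (fun ξ => T ξ (u ξ) (w ξ)) ξ η =
      T η (u ξ) (w ξ) + T ξ (fderiv ℝ u ξ η) (w ξ) + T ξ (u ξ) (fderiv ℝ w ξ η) := by
  have h := (((trilinCLM T).hasFDerivAt (x := ξ)).clm_apply hu.hasFDerivAt).clm_apply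
    hw.hasFDerivAt
  have h2 : HasFDerivAt (fun ξ => T ξ (u ξ) (w ξ)) _ ξ := h
  rw [h2.fderiv]
  simp [trilinCLM_apply]
  ring
end Trilinear

section LinearPoisson
variable {P : Type*} [NormedAddCommGroup P] [NormedSpace ℝ P] [FiniteDimensional ℝ P]
  (T : P →ₗ[ℝ] (P →L[ℝ] ℝ) →ₗ[ℝ] (P →L[ℝ] ℝ) →ₗ[ℝ] ℝ)

theorem contDiff_bracket {F G : P → ℝ} (hF : ContDiff ℝ ∞ F) (hG : ContDiff ℝ ∞ G) :
    ContDiff ℝ ∞ (fun ξ => T ξ (fderiv ℝ F ξ) (fderiv ℝ G ξ)) :=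
  contDiff_trilin T contDiff_id (hF.fderiv_right (by simp)) (hG.fderiv_right (by simp))

theorem fderiv_bracket {F G : P → ℝ} (hF : ContDiff ℝ ∞ F) (hG : ContDiff ℝ ∞ G) (ξ η : P) :
    fderiv ℝ (fun ξ => T ξ (fderiv ℝ F ξ) (fderiv ℝ G ξ)) ξ η =
      T η (fderiv ℝ F ξ) (fderiv ℝ G ξ) + T ξ (fderiv ℝ (fderiv ℝ F) ξ η) (fderiv ℝ G ξ) +
      T ξ (fderiv ℝ F ξ) (fderiv ℝ (fderiv ℝ G) ξ η) :=
  fderiv_trilin T ((hF.fderiv_right (m := ∞) (by simp)).differentiable (by simp) ξ)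
    ((hG.fderiv_right (m := ∞) (by simp)).differentiable (by simp) ξ) η

theorem jacobi_bracket (a : P → (P →L[ℝ] ℝ) → P) (ha : ∀ ξ φ ψ, T ξ φ ψ = ψ (a ξ φ))
    (anti : ∀ ξ φ ψ, T ξ φ ψ = - T ξ ψ φ)
    (jac : ∀ ξ φ ψ χ, T (a ξ φ) ψ χ + T (a ξ ψ) χ φ + T (a ξ χ) φ ψ = 0)
    {F G K : P → ℝ} (hF : ContDiff ℝ ∞ F) (hG : ContDiff ℝ ∞ G) (hK : ContDiff ℝ ∞ K) (ξ : P) :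
    T ξ (fderiv ℝ F ξ) (fderiv ℝ (fun ξ => T ξ (fderiv ℝ G ξ) (fderiv ℝ K ξ)) ξ) +
    T ξ (fderiv ℝ G ξ) (fderiv ℝ (fun ξ => T ξ (fderiv ℝ K ξ) (fderiv ℝ F ξ)) ξ) +
    T ξ (fderiv ℝ K ξ) (fderiv ℝ (fun ξ => T ξ (fderiv ℝ F ξ) (fderiv ℝ G ξ)) ξ) = 0 := by
  have sym : ∀ {F : P → ℝ}, ContDiff ℝ ∞ F → ∀ v w,
      fderiv ℝ (fderiv ℝ F) ξ v w = fderiv ℝ (fderiv ℝ F) ξ w v := fun hF v w =>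
    hF.contDiffAt.isSymmSndFDerivAt
      (by simpa using WithTop.coe_le_coe.2 (le_top (a := (2 : ℕ∞)))) v w
  rw [ha ξ (fderiv ℝ F ξ), ha ξ (fderiv ℝ G ξ), ha ξ (fderiv ℝ K ξ), fderiv_bracket T hG hK,
    fderiv_bracket T hK hF, fderiv_bracket T hF hG]
  have j := jac ξ (fderiv ℝ F ξ) (fderiv ℝ G ξ) (fderiv ℝ K ξ)
  rw [anti ξ (fderiv ℝ (fderiv ℝ G) ξ _), anti ξ (fderiv ℝ (fderiv ℝ K) ξ _),
    anti ξ (fderiv ℝ (fderiv ℝ F) ξ _)]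
  simp only [ha ξ]
  rw [sym hF (a ξ (fderiv ℝ G ξ)), sym hG (a ξ (fderiv ℝ K ξ)), sym hK (a ξ (fderiv ℝ F ξ))]
  linarith

end LinearPoisson

section KKS

/-- The dual space of a finite-dimensional real vector space `g`, with its canonical smooth structure. It
is normed by the sup norm of the coordinates in a basis; all norms are equivalent, so the smooth
functions do not depend on this choice. -/
def LieDual (g : Type*) [AddCommGroup g] [Module ℝ g] : Type _ := Module.Dual ℝ g

namespace LieDual
variable (g : Type*) [AddCommGroup g] [Module ℝ g] [FiniteDimensional ℝ g]

instance : NormedAddCommGroup (LieDual g) :=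
  NormedAddCommGroup.induced (Module.Dual ℝ g) _
    (Module.finBasis ℝ (Module.Dual ℝ g)).equivFun
    (Module.finBasis ℝ (Module.Dual ℝ g)).equivFun.injective

instance : NormedSpace ℝ (LieDual g) :=
  NormedSpace.induced ℝ (Module.Dual ℝ g) _ (Module.finBasis ℝ (Module.Dual ℝ g)).equivFun

def toDual : LieDual g ≃ₗ[ℝ] Module.Dual ℝ g := LinearEquiv.refl ℝ (Module.Dual ℝ g)

instance : FiniteDimensional ℝ (LieDual g) :=
  inferInstanceAs (FiniteDimensional ℝ (Module.Dual ℝ g))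
end LieDual

variable {ι : Type*} [Fintype ι] [DecidableEq ι] (g : ι → Type*) [∀ i, LieRing (g i)]
  [∀ i, LieAlgebra ℝ (g i)] [∀ i, FiniteDimensional ℝ (g i)]

/-- The product of the duals of the Lie algebras `g i`. -/
abbrev DualProd : Type _ := ∀ i, LieDual (g i)

/-- The part in `g i = (g i)**` of a covector on the product of the duals: the element `v` of `g i`
with `φ (0, …, ζ, …, 0) = ζ v` for every `ζ` in the dual of `g i`. -/
def covectorPart (i : ι) : (DualProd g →L[ℝ] ℝ) →ₗ[ℝ] g i :=
  (Module.evalEquiv ℝ (g i)).symm.toLinearMap ∘ₗ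
    LinearMap.lcomp ℝ ℝ (LinearMap.single ℝ (fun i => LieDual (g i)) i ∘ₗ
      (LieDual.toDual (g i)).symm.toLinearMap) ∘ₗ ContinuousLinearMap.coeLM ℝ

variable {g}
theorem covectorPart_spec (i : ι) (φ : DualProd g →L[ℝ] ℝ) (ζ : LieDual (g i)) :
    LieDual.toDual (g i) ζ (covectorPart g i φ) = φ (Pi.single i ζ) := by
  have : LieDual.toDual (g i) ζ (covectorPart g i φ) =
      Module.evalEquiv ℝ (g i) (covectorPart g i φ) (LieDual.toDual (g i) ζ) := rfl
  rw [this]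
  unfold covectorPart
  simp

theorem sum_covectorPart (φ : DualProd g →L[ℝ] ℝ) (ζ : DualProd g) :
    ∑ i, LieDual.toDual (g i) (ζ i) (covectorPart g i φ) = φ ζ := by
  simp only [covectorPart_spec]
  rw [← map_sum, Finset.univ_sum_single]

variable (g) in
/-- The product of the Kirillov-Kostant-Souriau Poisson tensors, at `ξ`, on two covectors:
the sum over `i` of `⟨ξ i, [φ i, ψ i]⟩`. -/
def kksTensor : DualProd g →ₗ[ℝ] (DualProd g →L[ℝ] ℝ) →ₗ[ℝ] (DualProd g →L[ℝ] ℝ) →ₗ[ℝ] ℝ where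
  toFun ξ := LinearMap.mk₂ ℝ
    (fun φ ψ => ∑ i, LieDual.toDual (g i) (ξ i) ⁅covectorPart g i φ, covectorPart g i ψ⁆)
    (fun a b c => by simp [Finset.sum_add_distrib])
    (fun r a b => by simp [Finset.mul_sum])
    (fun a b c => by simp [Finset.sum_add_distrib])
    (fun r a b => by simp [Finset.mul_sum])
  map_add' a b := by ext; simp [Finset.sum_add_distrib]
  map_smul' r a := by ext; simp [Finset.mul_sum]

theorem kksTensor_apply (ξ : DualProd g) (φ ψ : DualProd g →L[ℝ] ℝ) :
    kksTensor g ξ φ ψ =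
      ∑ i, LieDual.toDual (g i) (ξ i) ⁅covectorPart g i φ, covectorPart g i ψ⁆ := rfl

theorem kksTensor_anti (ξ : DualProd g) (φ ψ : DualProd g →L[ℝ] ℝ) :
    kksTensor g ξ φ ψ = - kksTensor g ξ ψ φ := by
  simp only [kksTensor_apply, ← Finset.sum_neg_distrib, ← map_neg, lie_skew]

def coadj (ξ : DualProd g) (φ : DualProd g →L[ℝ] ℝ) : DualProd g := fun i =>
  (LieDual.toDual (g i)).symm
    (LieDual.toDual (g i) (ξ i) ∘ₗ (LieModule.toEnd ℝ (g i) (g i) (covectorPart g i φ)))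

theorem coadj_apply (ξ : DualProd g) (φ : DualProd g →L[ℝ] ℝ) (i : ι) (v : g i) :
    LieDual.toDual (g i) (coadj ξ φ i) v = LieDual.toDual (g i) (ξ i) ⁅covectorPart g i φ, v⁆ := by
  simp [coadj]

theorem kksTensor_coadj (ξ : DualProd g) (φ ψ : DualProd g →L[ℝ] ℝ) :
    kksTensor g ξ φ ψ = ψ (coadj ξ φ) := by
  rw [← sum_covectorPart]
  simp only [coadj_apply, kksTensor_apply]

theorem kksTensor_jacobi (ξ : DualProd g) (φ ψ χ : DualProd g →L[ℝ] ℝ) :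
    kksTensor g (coadj ξ φ) ψ χ + kksTensor g (coadj ξ ψ) χ φ + kksTensor g (coadj ξ χ) φ ψ = 0 := by
  simp only [coadj_apply, kksTensor_apply, ← Finset.sum_add_distrib, ← map_add, lie_jacobi,
    map_zero, Finset.sum_const_zero]

/-- The bracket `{F, G}(ξ) = ∑ i, ⟨ξ i, [d_i F(ξ), d_i G(ξ)]⟩` of the product Poisson structure. -/
def kksBracket (F G : C^∞⟮𝓘(ℝ, DualProd g), DualProd g; 𝓘(ℝ, ℝ), ℝ⟯) :
    C^∞⟮𝓘(ℝ, DualProd g), DualProd g; 𝓘(ℝ, ℝ), ℝ⟯ :=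
  ⟨fun ξ => kksTensor g ξ (fderiv ℝ F ξ) (fderiv ℝ G ξ),
    (contDiff_bracket (kksTensor g) F.contMDiff.contDiff G.contMDiff.contDiff).contMDiff⟩

theorem kksBracket_apply (F G : C^∞⟮𝓘(ℝ, DualProd g), DualProd g; 𝓘(ℝ, ℝ), ℝ⟯)
    (ξ : DualProd g) : kksBracket F G ξ = ∑ i, LieDual.toDual (g i) (ξ i)
      ⁅covectorPart g i (fderiv ℝ F ξ), covectorPart g i (fderiv ℝ G ξ)⁆ := rfl

theorem fd_smooth (F : C^∞⟮𝓘(ℝ, DualProd g), DualProd g; 𝓘(ℝ, ℝ), ℝ⟯) (ξ : DualProd g) :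
    DifferentiableAt ℝ F ξ := F.contMDiff.contDiff.differentiable (by simp) ξ

theorem fd_add (F G : C^∞⟮𝓘(ℝ, DualProd g), DualProd g; 𝓘(ℝ, ℝ), ℝ⟯) (ξ : DualProd g) :
    fderiv ℝ (F + G : C^∞⟮𝓘(ℝ, DualProd g), DualProd g; 𝓘(ℝ, ℝ), ℝ⟯) ξ =
      fderiv ℝ F ξ + fderiv ℝ G ξ := fderiv_add (fd_smooth F ξ) (fd_smooth G ξ)

theorem fd_smul (r : ℝ) (F : C^∞⟮𝓘(ℝ, DualProd g), DualProd g; 𝓘(ℝ, ℝ), ℝ⟯) (ξ : DualProd g) :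
    fderiv ℝ (r • F : C^∞⟮𝓘(ℝ, DualProd g), DualProd g; 𝓘(ℝ, ℝ), ℝ⟯) ξ =
      r • fderiv ℝ F ξ := fderiv_const_smul (fd_smooth F ξ) r

theorem fd_mul (F G : C^∞⟮𝓘(ℝ, DualProd g), DualProd g; 𝓘(ℝ, ℝ), ℝ⟯) (ξ : DualProd g) :
    fderiv ℝ (F * G : C^∞⟮𝓘(ℝ, DualProd g), DualProd g; 𝓘(ℝ, ℝ), ℝ⟯) ξ =
      F ξ • fderiv ℝ G ξ + G ξ • fderiv ℝ F ξ := fderiv_mul (fd_smooth F ξ) (fd_smooth G ξ)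

theorem kksBracket_anti (F G : C^∞⟮𝓘(ℝ, DualProd g), DualProd g; 𝓘(ℝ, ℝ), ℝ⟯) :
    kksBracket F G = - kksBracket G F := by
  ext ξ; exact kksTensor_anti ξ _ _

theorem kksBracket_add (F G K : C^∞⟮𝓘(ℝ, DualProd g), DualProd g; 𝓘(ℝ, ℝ), ℝ⟯) :
    kksBracket F (G + K) = kksBracket F G + kksBracket F K := by
  ext ξ
  show kksTensor g ξ _ (fderiv ℝ (G + K : C^∞⟮𝓘(ℝ, DualProd g), DualProd g; 𝓘(ℝ, ℝ), ℝ⟯) ξ) = _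
  rw [fd_add, map_add]; rfl

theorem kksBracket_smul (F G : C^∞⟮𝓘(ℝ, DualProd g), DualProd g; 𝓘(ℝ, ℝ), ℝ⟯) (r : ℝ) :
    kksBracket F (r • G) = r • kksBracket F G := by
  ext ξ
  show kksTensor g ξ _ (fderiv ℝ (r • G : C^∞⟮𝓘(ℝ, DualProd g), DualProd g; 𝓘(ℝ, ℝ), ℝ⟯) ξ) = _
  rw [fd_smul, map_smul]; rfl

theorem kksBracket_mul (F G K : C^∞⟮𝓘(ℝ, DualProd g), DualProd g; 𝓘(ℝ, ℝ), ℝ⟯) :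
    kksBracket F (G * K) = G * kksBracket F K + kksBracket F G * K := by
  ext ξ
  show kksTensor g ξ _ (fderiv ℝ (G * K : C^∞⟮𝓘(ℝ, DualProd g), DualProd g; 𝓘(ℝ, ℝ), ℝ⟯) ξ) =
    G ξ * kksTensor g ξ _ _ + kksTensor g ξ _ _ * K ξ
  rw [fd_mul, map_add, map_smul, map_smul, smul_eq_mul, smul_eq_mul, mul_comm (K ξ)]

instance : PoissonAlgebra C^∞⟮𝓘(ℝ, ∀ i, LieDual (g i)), ∀ i, LieDual (g i); 𝓘(ℝ, ℝ), ℝ⟯ where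
  poissonBracket := LinearMap.mk₂ ℝ kksBracket
    (fun a b c => by
      rw [kksBracket_anti, kksBracket_add, neg_add, ← kksBracket_anti, ← kksBracket_anti])
    (fun r a c => by rw [kksBracket_anti, kksBracket_smul, ← smul_neg, ← kksBracket_anti])
    kksBracket_add (fun r a b => kksBracket_smul a b r)
  pb_self F := by
    ext ξ
    show ∑ i, LieDual.toDual (g i) (ξ i) ⁅_, _⁆ = 0
    simp only [lie_self, map_zero, Finset.sum_const_zero]
  jacobi a b c := by
    ext ξ
    exact jacobi_bracket (kksTensor g) coadj kksTensor_coadj kksTensor_anti kksTensor_jacobi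
      a.contMDiff.contDiff b.contMDiff.contDiff c.contMDiff.contDiff ξ
  leibniz a b c := by
    show kksBracket (b * c) a = b * kksBracket c a + kksBracket b a * c
    rw [kksBracket_anti, kksBracket_mul, kksBracket_anti a c, kksBracket_anti a b]
    ring

theorem kks_apply (F G : C^∞⟮𝓘(ℝ, ∀ i, LieDual (g i)), ∀ i, LieDual (g i); 𝓘(ℝ, ℝ), ℝ⟯)
    (ξ : ∀ i, LieDual (g i)) : PoissonAlgebra.poissonBracket F G ξ = ∑ i, LieDual.toDual (g i) (ξ i)
      ⁅covectorPart g i (fderiv ℝ F ξ), covectorPart g i (fderiv ℝ G ξ)⁆ := rfl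
end KKS

open Set Bundle VectorField Topology

/-! ## Products of manifolds -/

section PiManifold
variable {ι : Type*} [Fintype ι] {E : ι → Type*} [∀ i, NormedAddCommGroup (E i)]
  [∀ i, NormedSpace ℝ (E i)] {H : ι → Type*} [∀ i, TopologicalSpace (H i)]
  {I : ∀ i, ModelWithCorners ℝ (E i) (H i)}
  {M : ι → Type*} [∀ i, TopologicalSpace (M i)] [∀ i, ChartedSpace (H i) (M i)]
  {F : Type*} [NormedAddCommGroup F] [NormedSpace ℝ F] {G : Type*} [TopologicalSpace G]
  {J : ModelWithCorners ℝ F G} {N : Type*} [TopologicalSpace N] [ChartedSpace G N]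

instance isManifold_pi [∀ i, IsManifold (I i) ∞ (M i)] :
    IsManifold (ModelWithCorners.pi I) ∞ (∀ i, M i) := by
  apply isManifold_of_contDiffOn
  rintro _ _ ⟨e, he, rfl⟩ ⟨e', he', rfl⟩
  rw [contDiffOn_pi]
  intro i
  have h : ContDiffOn ℝ ∞ (I i ∘ (e i).symm ≫ₕ e' i ∘ (I i).symm)
      ((I i).symm ⁻¹' ((e i).symm ≫ₕ e' i).source ∩ range (I i)) :=
    ((contDiffGroupoid ∞ (I i)).compatible (he i trivial) (he' i trivial)).1
  refine h.comp (t := (I i).symm ⁻¹' ((e i).symm ≫ₕ e' i).source ∩ range (I i))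
    ((ContinuousLinearMap.proj (R := ℝ) (φ := E) i).contDiff.contDiffOn) ?_
  rintro x ⟨⟨hx1, hx2⟩, y, rfl⟩
  exact ⟨⟨hx1 i trivial, hx2 i trivial⟩, y i, rfl⟩

instance boundaryless_pi [∀ i, (I i).Boundaryless] : (ModelWithCorners.pi I).Boundaryless where
  range_eq_univ := by
    have : range (ModelWithCorners.pi I) = range (Pi.map fun i => I i) := rfl
    rw [this, Set.range_piMap]
    simp [ModelWithCorners.range_eq_univ]

theorem contMDiffWithinAt_pi {f : N → ∀ i, M i} {s : Set N} {x : N} {n : WithTop ℕ∞} :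
    ContMDiffWithinAt J (ModelWithCorners.pi I) n f s x ↔
      ∀ i, ContMDiffWithinAt J (I i) n (fun y => f y i) s x := by
  simp only [contMDiffWithinAt_iff, continuousWithinAt_pi, forall_and]
  exact and_congr_right fun _ => contDiffWithinAt_pi

theorem hasMFDerivWithinAt_pi {f : N → ∀ i, M i} {s : Set N} {x : N}
    {f' : ∀ i, TangentSpace J x →L[ℝ] TangentSpace (I i) (f x i)} :
    HasMFDerivWithinAt J (ModelWithCorners.pi I) f s x
      (ContinuousLinearMap.pi (φ := fun i => TangentSpace (I i) (f x i)) f') ↔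
      ∀ i, HasMFDerivWithinAt J (I i) (fun y => f y i) s x (f' i) := by
  simp only [HasMFDerivWithinAt, continuousWithinAt_pi, forall_and]
  exact and_congr_right fun _ => hasFDerivWithinAt_pi
end PiManifold

/-! ## The generalized tangent bundle -/

section Defs
variable {E : Type*} [NormedAddCommGroup E] [NormedSpace ℝ E] {H : Type*} [TopologicalSpace H]
  (I : ModelWithCorners ℝ E H) {M : Type*} [TopologicalSpace M] [ChartedSpace H M]

/-- The fibre `T_x M ⊕ T_x^* M` of the generalized tangent bundle. -/
abbrev GenTangent (x : M) : Type _ := TangentSpace I x × (TangentSpace I x →L[ℝ] ℝ)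

/-- Smoothness at a point of a vector field, as a section of the tangent bundle. -/
abbrev SmoothVFAt [IsManifold I ∞ M] (X : ∀ x : M, TangentSpace I x) (x : M) : Prop :=
  ContMDiffAt I I.tangent ∞ (fun x => (TotalSpace.mk' E x (X x) : TangentBundle I M)) x

/-- Smoothness at a point of a one-form, as a section of the cotangent bundle. -/
abbrev SmoothOneFormAt [IsManifold I ∞ M] (α : ∀ x : M, TangentSpace I x →L[ℝ] ℝ) (x : M) : Prop :=
  ContMDiffAt I (I.prod 𝓘(ℝ, E →L[ℝ] ℝ)) ∞
    (fun x => (TotalSpace.mk' (E →L[ℝ] ℝ) x (α x) :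
      TotalSpace (E →L[ℝ] ℝ) (fun x : M => TangentSpace I x →L[ℝ] ℝ))) x

/-- The one-form `α` read in the preferred chart at `x`. -/
def chartOneForm (α : ∀ x : M, TangentSpace I x →L[ℝ] ℝ) (x : M) (y : E) : E →L[ℝ] ℝ :=
  (α ((extChartAt I x).symm y)) ∘L
    (mfderivWithin 𝓘(ℝ, E) I (extChartAt I x).symm (range I) y) ∘L
    ((NormedSpace.fromTangentSpace (𝕜 := ℝ) y).symm : E →L[ℝ] TangentSpace 𝓘(ℝ, E) y)

/-- The interior product `ι_v dα` at `x`, computed in the preferred chart at `x`: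
`dα(v, w) = (∂_v α)(w) - (∂_w α)(v)`. -/
def interiorExtDeriv (α : ∀ x : M, TangentSpace I x →L[ℝ] ℝ) (x : M) (v : TangentSpace I x) :
    TangentSpace I x →L[ℝ] ℝ :=
  let D : E →L[ℝ] E →L[ℝ] ℝ := fderivWithin ℝ (chartOneForm I α x) (range I) (extChartAt I x x)
  (D (mvfderiv I (extChartAt I x) x v) - D.flip (mvfderiv I (extChartAt I x) x v)) ∘L
    mvfderiv I (extChartAt I x) x
end Defs

/-! ## Calculus in charts -/

section Coord
variable {E : Type*} [NormedAddCommGroup E] [NormedSpace ℝ E] {H : Type*} [TopologicalSpace H]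
  {I : ModelWithCorners ℝ E H} {M : Type*} [TopologicalSpace M] [ChartedSpace H M]

variable (I) in
def chartVF (X : ∀ x : M, TangentSpace I x) (x : M) : E → E :=
  mpullbackWithin 𝓘(ℝ, E) I (extChartAt I x).symm X (range I)

theorem chart_pairing [IsManifold I ∞ M] (α : ∀ x : M, TangentSpace I x →L[ℝ] ℝ) (X : ∀ x : M, TangentSpace I x)
    (x : M) {y : E} (hy : y ∈ (extChartAt I x).target) :
    chartOneForm I α x y (chartVF I X x y) =
      α ((extChartAt I x).symm y) (X ((extChartAt I x).symm y)) := by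
  have h := isInvertible_mfderivWithin_extChartAt_symm (I := I) hy
  show α _ ((mfderivWithin 𝓘(ℝ, E) I (extChartAt I x).symm (range I) y)
    ((mfderivWithin 𝓘(ℝ, E) I (extChartAt I x).symm (range I) y).inverse _)) = _
  rw [h.self_apply_inverse]

theorem inverse_apply_of_eq_id (A : E →L[ℝ] E) (hA : A = ContinuousLinearMap.id ℝ E) (v : E) :
    A.inverse v = v := by
  subst hA; simp

theorem chartVF_self [IsManifold I ∞ M] (X : ∀ x : M, TangentSpace I x) (x : M) :
    chartVF I X x (extChartAt I x x) = X x := by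
  show (mfderivWithin 𝓘(ℝ, E) I (extChartAt I x).symm (range I) (extChartAt I x x)).inverse
    (X ((extChartAt I x).symm (extChartAt I x x))) = X x
  refine (inverse_apply_of_eq_id (E := E) _ mfderivWithin_range_extChartAt_symm _).trans ?_
  rw [extChartAt_to_inv]

theorem chartOneForm_self [IsManifold I ∞ M] (α : ∀ x : M, TangentSpace I x →L[ℝ] ℝ) (x : M) :
    chartOneForm I α x (extChartAt I x x) = α x := by
  unfold chartOneForm
  rw [mfderivWithin_range_extChartAt_symm, extChartAt_to_inv]
  rfl

theorem mvfderiv_ext_self [IsManifold I ∞ M] (x : M) (v : TangentSpace I x) :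
    mvfderiv I (extChartAt I x) x v = v := by
  unfold mvfderiv
  rw [mfderiv_extChartAt_self]; rfl

variable [I.Boundaryless]

theorem target_nhds (x : M) : ∀ᶠ y in 𝓝 (extChartAt I x x), y ∈ (extChartAt I x).target :=
  extChartAt_target_mem_nhds x

theorem interiorExtDeriv_apply [IsManifold I ∞ M] (α : ∀ x : M, TangentSpace I x →L[ℝ] ℝ) (x : M)
    (v w : TangentSpace I x) :
    interiorExtDeriv I α x v w =
      fderiv ℝ (chartOneForm I α x) (extChartAt I x x) v w -
      fderiv ℝ (chartOneForm I α x) (extChartAt I x x) w v := by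
  unfold interiorExtDeriv
  simp only [I.range_eq_univ, fderivWithin_univ]
  show (fderiv ℝ (chartOneForm I α x) (extChartAt I x x)) (mvfderiv I (extChartAt I x) x v) (mvfderiv I (extChartAt I x) x w) -
    (fderiv ℝ (chartOneForm I α x) (extChartAt I x x)) (mvfderiv I (extChartAt I x) x w) (mvfderiv I (extChartAt I x) x v) = _
  rw [mvfderiv_ext_self, mvfderiv_ext_self]

theorem mvfderiv_coord {f : M → ℝ} {x : M} (hf : MDifferentiableAt I 𝓘(ℝ, ℝ) f x)
    (v : TangentSpace I x) :
    mvfderiv I f x v = fderiv ℝ (f ∘ (extChartAt I x).symm) (extChartAt I x x) v := by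
  have h : mfderiv I 𝓘(ℝ, ℝ) f x =
      fderivWithin ℝ (writtenInExtChartAt I 𝓘(ℝ, ℝ) x f) (range I) (extChartAt I x x) := if_pos hf
  rw [I.range_eq_univ, fderivWithin_univ] at h
  show mfderiv I 𝓘(ℝ, ℝ) f x v = _
  rw [h]
  rfl

theorem mlieBracket_coord [IsManifold I ∞ M] (X Y : ∀ x : M, TangentSpace I x) (x : M) :
    mlieBracket I X Y x =
      fderiv ℝ (chartVF I Y x) (extChartAt I x x) (X x) -
      fderiv ℝ (chartVF I X x) (extChartAt I x x) (Y x) := by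
  rw [← mlieBracketWithin_univ, mlieBracketWithin_apply]
  refine (inverse_apply_of_eq_id (E := E) _ mfderiv_extChartAt_self _).trans ?_
  simp only [preimage_univ, univ_inter, I.range_eq_univ, lieBracketWithin]
  have h1 := chartVF_self X x
  have h2 := chartVF_self Y x
  unfold chartVF at *
  rw [I.range_eq_univ] at *
  rw [h1, h2]
  have e : ∀ (f : E → E) z, fderivWithin ℝ f univ z = fderiv ℝ f z := fun f z => by
    rw [fderivWithin_univ]
  exact congrArg₂ (fun a b : E →L[ℝ] E => a (X x) - b (Y x)) (e _ _) (e _ _)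

theorem differentiableAt_chartVF [FiniteDimensional ℝ E] [IsManifold I ∞ M] {X : ∀ x : M, TangentSpace I x} {x : M}
    (hX : MDifferentiableAt I I.tangent (fun x => (TotalSpace.mk' E x (X x) : TangentBundle I M)) x) :
    DifferentiableAt ℝ (chartVF I X x) (extChartAt I x x) := by
  have := FiniteDimensional.complete ℝ E
  have h := (hX.mdifferentiableWithinAt (s := univ)).differentiableWithinAt_mpullbackWithin_vectorField
  simp only [I.range_eq_univ, preimage_univ, univ_inter] at h
  unfold chartVF
  rw [I.range_eq_univ]
  exact h.differentiableAt Filter.univ_mem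

theorem oneFormAt_iff [IsManifold I ∞ M] {α : ∀ x : M, TangentSpace I x →L[ℝ] ℝ} {x : M} :
    SmoothOneFormAt I α x ↔
    ContMDiffAt I 𝓘(ℝ, E →L[ℝ] ℝ) ∞ (fun y => chartOneForm I α x (extChartAt I x y)) x := by
  have key := contMDiffAt_hom_bundle (IM := I) (IB := I) (n := ∞) (F₁ := E) (F₂ := ℝ)
    (E₁ := fun x : M => TangentSpace I x) (E₂ := Bundle.Trivial M ℝ) (x₀ := x)
    (fun x => (TotalSpace.mk' (E →L[ℝ] ℝ) x (α x) :
      TotalSpace (E →L[ℝ] ℝ) (fun x : M => TangentSpace I x →L[ℝ] Bundle.Trivial M ℝ x)))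
  refine key.trans ?_
  refine (and_iff_right (contMDiffAt_id (I := I) (x := x))).trans ?_
  have heq : ∀ y ∈ (chartAt H x).source,
      ContinuousLinearMap.inCoordinates E (fun x : M => TangentSpace I x) ℝ (Bundle.Trivial M ℝ)
        x y x y (α y) = chartOneForm I α x (extChartAt I x y) := by
    intro y hy
    unfold chartOneForm
    rw [(extChartAt I x).left_inv (by rwa [extChartAt_source])]
    ext v
    simp only [ContinuousLinearMap.inCoordinates]
    rw [TangentBundle.symmL_trivializationAt hy]
    simp
    rfl
  have hn : (chartAt H x).source ∈ 𝓝 x := chart_source_mem_nhds H x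
  exact ⟨fun h => h.congr_of_eventuallyEq (Filter.eventually_of_mem hn fun y hy => (heq y hy).symm),
    fun h => h.congr_of_eventuallyEq (Filter.eventually_of_mem hn fun y hy => heq y hy)⟩

theorem differentiableAt_chartOneForm [IsManifold I ∞ M]
    {α : ∀ x : M, TangentSpace I x →L[ℝ] ℝ} {x : M} (h : SmoothOneFormAt I α x) :
    DifferentiableAt ℝ (chartOneForm I α x) (extChartAt I x x) := by
  rw [oneFormAt_iff] at h
  have h2 := (h.mdifferentiableAt (by simp)).mdifferentiableWithinAt
    (s := univ) |>.differentiableWithinAt_comp_extChartAt_symm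
  simp only [I.range_eq_univ, preimage_univ, univ_inter] at h2
  refine (h2.differentiableAt Filter.univ_mem).congr_of_eventuallyEq ?_
  filter_upwards [target_nhds x] with y hy
  show _ = chartOneForm I α x (extChartAt I x ((extChartAt I x).symm y))
  rw [(extChartAt I x).right_inv hy]

theorem differentiableAt_chartVF' [FiniteDimensional ℝ E] [IsManifold I ∞ M]
    {X : ∀ x : M, TangentSpace I x} {x : M} (hX : SmoothVFAt I X x) :
    DifferentiableAt ℝ (chartVF I X x) (extChartAt I x x) :=
  differentiableAt_chartVF (hX.mdifferentiableAt (by simp))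

theorem contMDiffAt_pairing [IsManifold I ∞ M] {α : ∀ x : M, TangentSpace I x →L[ℝ] ℝ} {x : M}
    {X : ∀ x : M, TangentSpace I x} (h : SmoothOneFormAt I α x) (hX : SmoothVFAt I X x) :
    ContMDiffAt I 𝓘(ℝ, ℝ) ∞ (fun y => α y (X y)) x := by
  have := ContMDiffAt.clm_bundle_apply (IM := I) (IB := I) (n := ∞) (F₁ := E) (F₂ := ℝ)
    (E₁ := fun x : M => TangentSpace I x) (E₂ := Bundle.Trivial M ℝ) (ϕ := α) (v := X) h hX
  rw [Bundle.contMDiffAt_section] at this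
  exact this

theorem pairing_deriv [FiniteDimensional ℝ E] [IsManifold I ∞ M]
    {α : ∀ x : M, TangentSpace I x →L[ℝ] ℝ} {x : M}
    {X : ∀ x : M, TangentSpace I x} (h : SmoothOneFormAt I α x) (hX : SmoothVFAt I X x) (v : TangentSpace I x) :
    mvfderiv I (fun y => α y (X y)) x v =
      fderiv ℝ (chartOneForm I α x) (extChartAt I x x) v (X x) +
      α x (fderiv ℝ (chartVF I X x) (extChartAt I x x) v) := by
  rw [mvfderiv_coord ((contMDiffAt_pairing h hX).mdifferentiableAt (by simp))]
  have : ((fun y => α y (X y)) ∘ (extChartAt I x).symm) =ᶠ[𝓝 (extChartAt I x x)]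
      fun y => chartOneForm I α x y (chartVF I X x y) := by
    filter_upwards [target_nhds x] with y hy
    exact (chart_pairing α X x hy).symm
  rw [this.fderiv_eq,
    fderiv_clm_apply (differentiableAt_chartOneForm h) (differentiableAt_chartVF' hX),
    chartVF_self, chartOneForm_self]
  exact add_comm (G := ℝ) _ _

theorem koszul [FiniteDimensional ℝ E] [IsManifold I ∞ M]
    {α : ∀ x : M, TangentSpace I x →L[ℝ] ℝ} {x : M}
    {X Y : ∀ x : M, TangentSpace I x} (h : SmoothOneFormAt I α x) (hX : SmoothVFAt I X x) (hY : SmoothVFAt I Y x) :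
    interiorExtDeriv I α x (X x) (Y x) = mvfderiv I (fun y => α y (Y y)) x (X x) -
      mvfderiv I (fun y => α y (X y)) x (Y x) - α x (mlieBracket I X Y x) := by
  rw [pairing_deriv h hX, pairing_deriv h hY, interiorExtDeriv_apply, mlieBracket_coord]
  have e : ∀ (a : E →L[ℝ] ℝ) (A B : E) (p q : ℝ),
      p - q = p + a A - (q + a B) - a (A - B) := fun a A B p q => by rw [map_sub]; ring
  exact e (α x) _ _ _ _

theorem chartOneForm_mvfderiv [IsManifold I ∞ M] {f : M → ℝ} {x : M}
    (hf : ContMDiffAt I 𝓘(ℝ, ℝ) ∞ f x) :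
    chartOneForm I (fun y => mvfderiv I f y) x =ᶠ[𝓝 (extChartAt I x x)]
      fderiv ℝ (f ∘ (extChartAt I x).symm) := by
  have hf' : ∀ᶠ y in 𝓝 x, MDifferentiableAt I 𝓘(ℝ, ℝ) f y := by
    have h1 : ContMDiffAt I 𝓘(ℝ, ℝ) 1 f x := hf.of_le (by simp)
    have := (contMDiffAt_iff_contMDiffAt_nhds (by simp)).1 h1
    exact this.mono fun y hy => hy.mdifferentiableAt (by simp)
  have hc : Filter.Tendsto (extChartAt I x).symm (𝓝 (extChartAt I x x)) (𝓝 x) := by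
    have := (continuousAt_extChartAt_symm (I := I) x).tendsto
    rwa [extChartAt_to_inv] at this
  filter_upwards [target_nhds x, hc.eventually hf'] with y hy hfy
  have h1 : HasMFDerivAt 𝓘(ℝ, E) I (extChartAt I x).symm y
      (mfderivWithin 𝓘(ℝ, E) I (extChartAt I x).symm (range I) y) := by
    have := (mdifferentiableWithinAt_extChartAt_symm (I := I) hy).hasMFDerivWithinAt
    rw [I.range_eq_univ, hasMFDerivWithinAt_univ] at this
    rwa [I.range_eq_univ]
  have h2 : HasFDerivAt (f ∘ (extChartAt I x).symm)
      (chartOneForm I (fun y => mvfderiv I f y) x y) y := (hfy.hasMFDerivAt.comp y h1).hasFDerivAt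
  exact h2.fderiv.symm

theorem contDiffAt_chart [IsManifold I ∞ M] {f : M → ℝ} {x : M}
    (hf : ContMDiffAt I 𝓘(ℝ, ℝ) ∞ f x) :
    ContDiffAt ℝ ∞ (f ∘ (extChartAt I x).symm) (extChartAt I x x) := by
  have := (contMDiffAt_iff.1 hf).2
  rw [I.range_eq_univ, contDiffWithinAt_univ] at this
  exact this

theorem oneFormAt_mvfderiv [IsManifold I ∞ M] {f : M → ℝ} {x : M}
    (hf : ContMDiffAt I 𝓘(ℝ, ℝ) ∞ f x) : SmoothOneFormAt I (fun y => mvfderiv I f y) x := by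
  rw [oneFormAt_iff]
  have h : ContDiffAt ℝ ∞ (fderiv ℝ (f ∘ (extChartAt I x).symm)) (extChartAt I x x) :=
    (contDiffAt_chart hf).fderiv_right (by simp)
  have h2 := (h.congr_of_eventuallyEq (chartOneForm_mvfderiv hf)).contMDiffAt
  exact h2.comp x contMDiffAt_extChartAt

theorem interiorExtDeriv_mvfderiv [IsManifold I ∞ M] {f : M → ℝ} {x : M}
    (hf : ContMDiffAt I 𝓘(ℝ, ℝ) ∞ f x) (v : TangentSpace I x) :
    interiorExtDeriv I (fun y => mvfderiv I f y) x v = 0 := by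
  ext w
  rw [interiorExtDeriv_apply, (chartOneForm_mvfderiv hf).fderiv_eq]
  have h := (contDiffAt_chart hf).isSymmSndFDerivAt
    (by simpa using WithTop.coe_le_coe.2 (le_top (a := (2 : ℕ∞))))
  exact sub_eq_zero.2 (h v w)

theorem mvfderiv_mlieBracket [FiniteDimensional ℝ E] [IsManifold I ∞ M] {f : M → ℝ} {x : M}
    (hf : ContMDiffAt I 𝓘(ℝ, ℝ) ∞ f x) {X Y : ∀ x : M, TangentSpace I x}
    (hX : SmoothVFAt I X x) (hY : SmoothVFAt I Y x) :
    mvfderiv I f x (mlieBracket I X Y x) =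
      mvfderiv I (fun y => mvfderiv I f y (Y y)) x (X x) -
      mvfderiv I (fun y => mvfderiv I f y (X y)) x (Y x) := by
  have := koszul (oneFormAt_mvfderiv hf) hX hY
  rw [interiorExtDeriv_mvfderiv hf] at this
  simp only [zero_apply] at this
  linarith
end Coord

/-! ## Dirac structures and admissible functions -/

section Dirac
variable {E : Type*} [NormedAddCommGroup E] [NormedSpace ℝ E] {H : Type*} [TopologicalSpace H]
  (I : ModelWithCorners ℝ E H) {M : Type*} [TopologicalSpace M] [ChartedSpace H M]

/-- The symmetric pairing `⟨X + α, Y + β⟩ = (α(Y) + β(X)) / 2`. -/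
def genPairing {x : M} (e e' : GenTangent I x) : ℝ := (e.2 e'.1 + e'.2 e.1) / 2

def IsIsotropic {x : M} (W : Submodule ℝ (GenTangent I x)) : Prop :=
  ∀ e ∈ W, ∀ e' ∈ W, genPairing I e e' = 0

/-- Smoothness at a point of a section of the generalized tangent bundle. -/
def SmoothSectionAt [IsManifold I ∞ M] (e : ∀ x : M, GenTangent I x) (x : M) : Prop :=
  SmoothVFAt I (fun y => (e y).1) x ∧ SmoothOneFormAt I (fun y => (e y).2) x

/-- The Lie derivative of a one-form, by the formula `L_X β = d(β(X)) + ι_X dβ`. -/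
def lieDerivOneForm (X : ∀ x : M, TangentSpace I x) (β : ∀ x : M, TangentSpace I x →L[ℝ] ℝ)
    (x : M) : TangentSpace I x →L[ℝ] ℝ :=
  mvfderiv I (fun y => β y (X y)) x + interiorExtDeriv I β x (X x)

/-- The Dorfman bracket `[X + α, Y + β] = [X, Y] + L_X β - ι_Y dα`. -/
def dorfman (e e' : ∀ x : M, GenTangent I x) (x : M) : GenTangent I x :=
  (mlieBracket I (fun y => (e y).1) (fun y => (e' y).1) x,
    lieDerivOneForm I (fun y => (e y).1) (fun y => (e' y).2) x -
      interiorExtDeriv I (fun y => (e y).2) x (e' x).1)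

variable (M) in
/-- A Dirac structure on `M`: a smooth subbundle `L` of the generalized tangent bundle which is maximally
isotropic in each fibre and whose smooth sections are closed under the Dorfman bracket. Being a smooth
subbundle is expressed by smooth local frames. -/
structure DiracStructure [IsManifold I ∞ M] where
  L : ∀ x : M, Submodule ℝ (GenTangent I x)
  maximal_isotropic : ∀ x, Maximal (IsIsotropic I) (L x)
  exists_frame : ∀ x, ∃ U : Set M, IsOpen U ∧ x ∈ U ∧
    ∃ (r : ℕ) (s : Fin r → ∀ y : M, GenTangent I y), (∀ j, ∀ y ∈ U, SmoothSectionAt I (s j) y) ∧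
      ∀ y ∈ U, LinearIndependent ℝ (fun j => s j y) ∧
        Submodule.span ℝ (range fun j => s j y) = L y
  involutive : ∀ e e' : ∀ x : M, GenTangent I x,
    (∀ x, SmoothSectionAt I e x) → (∀ x, e x ∈ L x) →
    (∀ x, SmoothSectionAt I e' x) → (∀ x, e' x ∈ L x) → ∀ x, dorfman I e e' x ∈ L x

variable {I}

/-- `X` is a smooth vector field with `X + df` a section of `L`. -/
def IsHamiltonian [IsManifold I ∞ M] (D : DiracStructure I M) (f : M → ℝ)
    (X : ∀ x : M, TangentSpace I x) : Prop :=
  (∀ x, SmoothVFAt I X x) ∧ ∀ x, ((X x, mvfderiv I f x) : GenTangent I x) ∈ D.L x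

theorem md_smooth (f : C^∞⟮I, M; 𝓘(ℝ, ℝ), ℝ⟯) (x : M) : MDifferentiableAt I 𝓘(ℝ, ℝ) f x :=
  (f.contMDiff x).mdifferentiableAt (by simp)

theorem vf_add [IsManifold I ∞ M] {X Y : ∀ x : M, TangentSpace I x} {x : M} (hX : SmoothVFAt I X x)
    (hY : SmoothVFAt I Y x) : SmoothVFAt I (fun y => X y + Y y) x := hX.add_section hY

theorem vf_smul [IsManifold I ∞ M] {X : ∀ x : M, TangentSpace I x} {x : M} {f : M → ℝ}
    (hf : ContMDiffAt I 𝓘(ℝ, ℝ) ∞ f x) (hX : SmoothVFAt I X x) : SmoothVFAt I (fun y => f y • X y) x :=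
  hf.smul_section hX

theorem vf_zero [IsManifold I ∞ M] (x : M) : SmoothVFAt I (fun y => (0 : TangentSpace I y)) x :=
  Bundle.contMDiff_zeroSection ℝ (fun x : M => TangentSpace I x) x

theorem vf_neg [IsManifold I ∞ M] {X : ∀ x : M, TangentSpace I x} {x : M} (hX : SmoothVFAt I X x) :
    SmoothVFAt I (fun y => - X y) x := hX.neg_section

/-- The admissible functions of a Dirac structure: the smooth functions that have a Hamiltonian vector
field. -/
def Adm [IsManifold I ∞ M] (D : DiracStructure I M) : Subalgebra ℝ C^∞⟮I, M; 𝓘(ℝ, ℝ), ℝ⟯ where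
  carrier := {f | ∃ X, IsHamiltonian D f X}
  mul_mem' := by
    rintro f g ⟨X, hX, hX'⟩ ⟨Y, hY, hY'⟩
    refine ⟨fun x => f x • Y x + g x • X x, fun x => vf_add (vf_smul (f.contMDiff x) (hY x))
      (vf_smul (g.contMDiff x) (hX x)), fun x => ?_⟩
    have : mvfderiv I (f * g : C^∞⟮I, M; 𝓘(ℝ, ℝ), ℝ⟯) x =
        f x • mvfderiv I g x + g x • mvfderiv I f x := mvfderiv_mul (md_smooth f x) (md_smooth g x)
    rw [this]
    exact (D.L x).add_mem ((D.L x).smul_mem (f x) (hY' x)) ((D.L x).smul_mem (g x) (hX' x))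
  add_mem' := by
    rintro f g ⟨X, hX, hX'⟩ ⟨Y, hY, hY'⟩
    refine ⟨fun x => X x + Y x, fun x => vf_add (hX x) (hY x), fun x => ?_⟩
    have : mvfderiv I (f + g : C^∞⟮I, M; 𝓘(ℝ, ℝ), ℝ⟯) x = mvfderiv I f x + mvfderiv I g x :=
      mvfderiv_add (md_smooth f x) (md_smooth g x)
    rw [this]
    exact (D.L x).add_mem (hX' x) (hY' x)
  algebraMap_mem' := by
    intro r
    refine ⟨fun _ => 0, vf_zero, fun x => ?_⟩
    have : mvfderiv I (algebraMap ℝ C^∞⟮I, M; 𝓘(ℝ, ℝ), ℝ⟯ r) x = 0 := mvfderiv_const r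
    rw [this]
    exact (D.L x).zero_mem

namespace Adm
variable [IsManifold I ∞ M] {D : DiracStructure I M}

/-- A Hamiltonian vector field of an admissible function. The bracket below does not depend on this
choice, see `bracketFun_eq`. -/
def hamVF (f : Adm D) : ∀ x : M, TangentSpace I x := f.2.choose

theorem hamVF_spec (f : Adm D) : IsHamiltonian D f.1 (hamVF f) := f.2.choose_spec

theorem isotropic {x : M} {v w : TangentSpace I x} {α β : TangentSpace I x →L[ℝ] ℝ}
    (h : ((v, α) : GenTangent I x) ∈ D.L x) (h' : ((w, β) : GenTangent I x) ∈ D.L x) :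
    - β v = α w := by
  have : (α w + β v) / 2 = 0 := (D.maximal_isotropic x).1 _ h _ h'
  linarith

def bracketFun (f g : Adm D) (x : M) : ℝ := - mvfderiv I g.1 x (hamVF f x)

theorem bracketFun_eq (f g : Adm D) {X : ∀ x : M, TangentSpace I x} (hX : IsHamiltonian D f.1 X)
    (x : M) : bracketFun f g x = - mvfderiv I g.1 x (X x) :=
  (isotropic ((hamVF_spec f).2 x) ((hamVF_spec g).2 x)).trans
    (isotropic (hX.2 x) ((hamVF_spec g).2 x)).symm

theorem bracketFun_anti (f g : Adm D) (x : M) : bracketFun f g x = - bracketFun g f x := by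
  refine (isotropic ((hamVF_spec f).2 x) ((hamVF_spec g).2 x)).trans ?_
  unfold bracketFun; ring

variable [I.Boundaryless]

theorem bracketFun_contMDiff (f g : Adm D) : ContMDiff I 𝓘(ℝ, ℝ) ∞ (bracketFun f g) := by
  intro x
  have := contMDiffAt_pairing (oneFormAt_mvfderiv (g.1.contMDiff x)) ((hamVF_spec f).1 x)
  exact this.neg

variable [FiniteDimensional ℝ E]

theorem vf_lieBracket {X Y : ∀ x : M, TangentSpace I x} (hX : ∀ x, SmoothVFAt I X x)
    (hY : ∀ x, SmoothVFAt I Y x) (x : M) : SmoothVFAt I (mlieBracket I X Y) x := by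
  have := FiniteDimensional.complete ℝ E
  have : IsManifold I (((⊤ : ℕ∞) : WithTop ℕ∞) + 1) M := by simpa
  have : IsManifold I (minSmoothness ℝ 2) M := by
    rw [minSmoothness_of_isRCLikeNormedField]
    exact IsManifold.of_le (n := ∞) (WithTop.coe_le_coe.2 (le_top (a := (2 : ℕ∞))))
  exact ContMDiffAt.mlieBracket_vectorField (m := ⊤) (n := ⊤) (hX x) (hY x) (by simp)

theorem isHamiltonian_bracket (f g : Adm D) {X Y : ∀ x : M, TangentSpace I x}
    (hX : IsHamiltonian D f.1 X) (hY : IsHamiltonian D g.1 Y) :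
    IsHamiltonian D (bracketFun f g) (fun x => - mlieBracket I X Y x) := by
  refine ⟨fun x => vf_neg (vf_lieBracket hX.1 hY.1 x), fun x => ?_⟩
  have h := D.involutive (fun x => (X x, mvfderiv I f.1 x)) (fun x => (Y x, mvfderiv I g.1 x))
    (fun x => ⟨hX.1 x, oneFormAt_mvfderiv (f.1.contMDiff x)⟩) hX.2
    (fun x => ⟨hY.1 x, oneFormAt_mvfderiv (g.1.contMDiff x)⟩) hY.2 x
  have h2 := (D.L x).neg_mem h
  have hb : bracketFun f g = - fun x => mvfderiv I g.1 x (X x) :=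
    funext fun x => bracketFun_eq f g hX x
  have he : - dorfman I (fun x => (X x, mvfderiv I f.1 x)) (fun x => (Y x, mvfderiv I g.1 x)) x =
      (- mlieBracket I X Y x, mvfderiv I (bracketFun f g) x) := by
    rw [hb, mvfderiv_neg]
    unfold dorfman lieDerivOneForm
    dsimp only
    rw [interiorExtDeriv_mvfderiv (f.1.contMDiff x), interiorExtDeriv_mvfderiv (g.1.contMDiff x),
      add_zero, sub_zero]
    rfl
  rw [he] at h2
  exact h2

/-- The bracket `{f, g} = - X_f g` of admissible functions. -/
def bracket (f g : Adm D) : Adm D :=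
  ⟨⟨bracketFun f g, bracketFun_contMDiff f g⟩,
    ⟨_, isHamiltonian_bracket f g (hamVF_spec f) (hamVF_spec g)⟩⟩

theorem bracket_apply (f g : Adm D) (x : M) :
    (bracket f g).1 x = - mvfderiv I g.1 x (hamVF f x) := rfl

theorem bracket_apply_of (f g : Adm D) {X : ∀ x : M, TangentSpace I x}
    (hX : IsHamiltonian D f.1 X) (x : M) :
    (bracket f g).1 x = - mvfderiv I g.1 x (X x) := bracketFun_eq f g hX x

theorem bracket_anti (f g : Adm D) : bracket f g = - bracket g f := by
  ext x; exact bracketFun_anti f g x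

theorem bracket_add (f g h : Adm D) : bracket f (g + h) = bracket f g + bracket f h := by
  ext x
  show - mvfderiv I (g.1 + h.1 : C^∞⟮I, M; 𝓘(ℝ, ℝ), ℝ⟯) x _ = - mvfderiv I g.1 x _ + - mvfderiv I h.1 x _
  have : mvfderiv I (g.1 + h.1 : C^∞⟮I, M; 𝓘(ℝ, ℝ), ℝ⟯) x = mvfderiv I g.1 x + mvfderiv I h.1 x :=
    mvfderiv_add (md_smooth g.1 x) (md_smooth h.1 x)
  rw [this]
  exact neg_add _ _

theorem bracket_mul (f g h : Adm D) : bracket f (g * h) = g * bracket f h + bracket f g * h := by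
  ext x
  show - mvfderiv I (g.1 * h.1 : C^∞⟮I, M; 𝓘(ℝ, ℝ), ℝ⟯) x _ =
    g.1 x * (- mvfderiv I h.1 x _) + (- mvfderiv I g.1 x _) * h.1 x
  have : mvfderiv I (g.1 * h.1 : C^∞⟮I, M; 𝓘(ℝ, ℝ), ℝ⟯) x =
      g.1 x • mvfderiv I h.1 x + h.1 x • mvfderiv I g.1 x :=
    mvfderiv_mul (md_smooth g.1 x) (md_smooth h.1 x)
  rw [this]
  have e : ∀ (a b : TangentSpace I x →L[ℝ] ℝ) (p q : ℝ) (v : TangentSpace I x),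
      - (p • a + q • b) v = p * (- a v) + (- b v) * q := fun a b p q v => by
    simp only [add_apply, smul_apply, smul_eq_mul]; ring
  exact e _ _ _ _ _

theorem bracket_algebraMap (f : Adm D) (r : ℝ) : bracket f (algebraMap ℝ (Adm D) r) = 0 := by
  ext x
  show - mvfderiv I (algebraMap ℝ C^∞⟮I, M; 𝓘(ℝ, ℝ), ℝ⟯ r) x _ = 0
  have : mvfderiv I (algebraMap ℝ C^∞⟮I, M; 𝓘(ℝ, ℝ), ℝ⟯ r) x = 0 := mvfderiv_const r
  rw [this]
  exact neg_zero

theorem bracket_smul (f g : Adm D) (r : ℝ) : bracket f (r • g) = r • bracket f g := by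
  rw [Algebra.smul_def, bracket_mul, bracket_algebraMap, zero_mul, add_zero, Algebra.smul_def]

theorem bracket_self (f : Adm D) : bracket f f = 0 := by
  have := bracket_anti f f
  ext x
  have h := congrArg (fun u : Adm D => u.1 x) this
  have h' : (bracket f f).1 x = - (bracket f f).1 x := h
  show (bracket f f).1 x = 0
  linarith

theorem bracket_bracket (f g h : Adm D) :
    bracket (bracket f g) h = bracket f (bracket g h) - bracket g (bracket f h) := by
  ext x
  refine (bracket_apply_of (bracket f g) h
    (isHamiltonian_bracket f g (hamVF_spec f) (hamVF_spec g)) x).trans ?_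
  have e : ∀ (a : TangentSpace I x →L[ℝ] ℝ) v, - a (- v) = a v := fun a v => by simp
  refine (e _ _).trans ((mvfderiv_mlieBracket (h.1.contMDiff x) ((hamVF_spec f).1 x)
    ((hamVF_spec g).1 x)).trans ?_)
  have n : ∀ (u : M → ℝ) v, mvfderiv I u x v = - mvfderiv I (- u) x v := fun u v => by
    rw [mvfderiv_neg]; exact (neg_neg _).symm
  rw [n, n (fun y => mvfderiv I h.1 y (hamVF f y))]
  rfl

instance : PoissonAlgebra (Adm D) where
  poissonBracket := LinearMap.mk₂ ℝ bracket
    (fun a b c => by rw [bracket_anti, bracket_add, neg_add, ← bracket_anti, ← bracket_anti])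
    (fun r a c => by rw [bracket_anti, bracket_smul, ← smul_neg, ← bracket_anti])
    bracket_add (fun r a b => bracket_smul a b r)
  pb_self := bracket_self
  jacobi a b c := by
    show bracket a (bracket b c) + bracket b (bracket c a) + bracket c (bracket a b) = 0
    have n : bracket b (-bracket a c) = - bracket b (bracket a c) := by
      have := bracket_smul b (bracket a c) (-1)
      simpa using this
    rw [bracket_anti c (bracket a b), bracket_bracket, bracket_anti c a, n]
    abel
  leibniz a b c := by
    show bracket (b * c) a = b * bracket c a + bracket b a * c
    rw [bracket_anti, bracket_mul, bracket_anti a c, bracket_anti a b]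
    ring

theorem pb_apply (f g : Adm D) {X : ∀ x : M, TangentSpace I x}
    (hX : IsHamiltonian D f.1 X) (x : M) :
    (PoissonAlgebra.poissonBracket f g).1 x = - mvfderiv I g.1 x (X x) := bracketFun_eq f g hX x
end Adm
end Dirac

section Product
variable {ι : Type*} [Fintype ι] {E : ι → Type*} [∀ i, NormedAddCommGroup (E i)]
  [∀ i, NormedSpace ℝ (E i)] {H : ι → Type*} [∀ i, TopologicalSpace (H i)]
  {I : ∀ i, ModelWithCorners ℝ (E i) (H i)}
  {M : ι → Type*} [∀ i, TopologicalSpace (M i)] [∀ i, ChartedSpace (H i) (M i)]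
  [∀ i, IsManifold (I i) ∞ (M i)]

/-- The product of Dirac structures: the family of subspaces which corresponds to the product of the
`(D i).L (p i)` under the identification of `T_p (∏ M i) ⊕ T_p^* (∏ M i)` with the product of the
`T_{p i} M i ⊕ T_{p i}^* M i`. A pair `(v, α)` corresponds to the family of the pairs `(d pr_i v, β i)`
where `α = ∑ i, β i ∘ d pr_i`. -/
def prodDirac (D : ∀ i, DiracStructure (I i) (M i)) (p : ∀ i, M i) :
    Submodule ℝ (GenTangent (ModelWithCorners.pi I) p) where
  carrier := {e | ∃ β : ∀ i, TangentSpace (I i) (p i) →L[ℝ] ℝ,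
    (∀ i, ((mfderiv (ModelWithCorners.pi I) (I i) (fun q => q i) p e.1, β i) :
      GenTangent (I i) (p i)) ∈ (D i).L (p i)) ∧
    e.2 = ∑ i, β i ∘L mfderiv (ModelWithCorners.pi I) (I i) (fun q => q i) p}
  add_mem' := by
    rintro e f ⟨β, hβ, he⟩ ⟨γ, hγ, hf⟩
    refine ⟨fun i => β i + γ i, fun i => ?_, ?_⟩
    · have := ((D i).L (p i)).add_mem (hβ i) (hγ i)
      rw [Prod.fst_add, map_add]
      exact this
    · rw [Prod.snd_add, he, hf, ← Finset.sum_add_distrib]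
      rfl
  zero_mem' := by
    refine ⟨fun i => 0, fun i => ?_, ?_⟩
    · rw [Prod.fst_zero, map_zero]
      exact ((D i).L (p i)).zero_mem
    · simp
  smul_mem' := by
    rintro r e ⟨β, hβ, he⟩
    refine ⟨fun i => r • β i, fun i => ?_, ?_⟩
    · have := ((D i).L (p i)).smul_mem r (hβ i)
      rw [Prod.smul_fst, map_smul]
      exact this
    · rw [Prod.smul_snd, he, Finset.smul_sum]
      rfl
end Product

section Momentum
variable {E : Type*} [NormedAddCommGroup E] [NormedSpace ℝ E] {H : Type*} [TopologicalSpace H]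
  {I : ModelWithCorners ℝ E H} {M : Type*} [TopologicalSpace M] [ChartedSpace H M]
  [IsManifold I ∞ M] {D : DiracStructure I M} {g : Type*} [AddCommGroup g] [Module ℝ g]
  [FiniteDimensional ℝ g]

/-- The momentum map of `φ`: `⟨J_φ(x), v⟩ = φ(v)(x)`. -/
def momentumMap (φ : g →ₗ[ℝ] Adm D) (x : M) : LieDual g :=
  (LieDual.toDual g).symm
    { toFun := fun v => (φ v).1 x
      map_add' := fun v w => by rw [map_add]; rfl
      map_smul' := fun r v => by rw [map_smul]; rfl }
end Momentum

end

/-! The pairing on the product is the sum of the pairings of the components (`modelPairing_eq_sum`),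
and membership in the product is tested component by component (`mem_prodDirac`). Hence the product
is isotropic. An element of a larger isotropic subspace has each component orthogonal to a factor `L
i`, so that component lies in `L i`, since a maximal isotropic subspace equals its own orthogonal
(`mem_of_maximal_isotropic`). Frames of the factors, lifted and put together, give a frame of the
product.

Involutivity is the delicate point, because a section of the product depends on all variables in
every component. By self-orthogonality it is enough that `⟨⟦e, e'⟧, f⟩ = 0` for `f` in the fibre. In
a chart this number is a combination of three pairings of a directional derivative of `e` or `e'`
with an element of the fibre (`modelPairing_dorfman`). If a direction has zero `i`-th coordinate,
then along it the `i`-th component stays in the fixed subspace `L i (p i)`, so its derivative lies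
there too and pairs to zero. Each pairing is therefore the sum over `i` of the same pairing for the
slices of the sections through `p`. The slices are global smooth sections of the factors, no local
section has to be extended, and involutivity of each `L i` makes every summand vanish.

For the pullback, write `J` for the product of the momentum maps and `b a` for a basis of `g i`.
Since `d⟨J, u⟩ = d(φ i u)` for `u` in `g i`, the differential of `F ∘ J` is the sum of the `c i a •
d(φ i (b a))`, where `c i a` is a coordinate of `d_i F` along `J`. The same combination of the
Hamiltonian fields of the `φ i (b a)` is a smooth Hamiltonian field of `F ∘ J`
(`isHamiltonian_pullbackVF`). Applying it to `G ∘ J` and using that `φ i` is a Lie morphism gives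
the linear Poisson bracket. -/

noncomputable section

open Set Bundle VectorField Topology

/-! ### Vector fields read in a chart -/

section ChartDeriv
variable {E : Type*} [NormedAddCommGroup E] [NormedSpace ℝ E] {H : Type*} [TopologicalSpace H]
  (I : ModelWithCorners ℝ E H) {M : Type*} [TopologicalSpace M] [ChartedSpace H M]

/-- The derivative at `y` of the inverse of the preferred chart at `x`, as a map of model spaces. -/
def chartSymmDeriv (x : M) (y : E) : E →L[ℝ] E :=
  mfderivWithin 𝓘(ℝ, E) I (extChartAt I x).symm (range I) y

theorem chartVF_apply (X : ∀ x : M, TangentSpace I x) (x : M) (y : E) :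
    chartVF I X x y = (chartSymmDeriv I x y).inverse (X ((extChartAt I x).symm y)) := rfl

variable {I} [IsManifold I ∞ M]

theorem isInvertible_chartSymmDeriv {x : M} {y : E} (hy : y ∈ (extChartAt I x).target) :
    (chartSymmDeriv I x y).IsInvertible :=
  isInvertible_mfderivWithin_extChartAt_symm hy

theorem hasMFDerivAt_extChartAt_symm [I.Boundaryless] {x : M} {y : E}
    (hy : y ∈ (extChartAt I x).target) :
    HasMFDerivAt 𝓘(ℝ, E) I (extChartAt I x).symm y
      (mfderivWithin 𝓘(ℝ, E) I (extChartAt I x).symm (range I) y) := by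
  have := (mdifferentiableWithinAt_extChartAt_symm (I := I) hy).hasMFDerivWithinAt
  rw [I.range_eq_univ, hasMFDerivWithinAt_univ] at this
  rwa [I.range_eq_univ]

theorem chartSymmDeriv_self (x : M) :
    chartSymmDeriv I x (extChartAt I x x) = ContinuousLinearMap.id ℝ E :=
  mfderivWithin_range_extChartAt_symm

/-- Identifies a chart reading by its pushforward, so that no inverse has to be computed. -/
theorem chartVF_eq_of_chartSymmDeriv {X : ∀ x : M, TangentSpace I x} {x : M} {y v : E}
    (hy : y ∈ (extChartAt I x).target)
    (h : chartSymmDeriv I x y v = X ((extChartAt I x).symm y)) : chartVF I X x y = v := by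
  rw [chartVF_apply]
  have h2 : (chartSymmDeriv I x y).inverse (chartSymmDeriv I x y v) = v :=
    (isInvertible_chartSymmDeriv hy).inverse_apply_self _
  exact (congrArg (chartSymmDeriv I x y).inverse h.symm).trans h2

/-- On the chart domain at `x`, the trivialization of the tangent bundle is the derivative of the
chart, which is inverse to `chartSymmDeriv`; so both readings agree near `x`. This is the
counterpart of `oneFormAt_iff`. -/
theorem vfAt_iff {X : ∀ x : M, TangentSpace I x} {x : M} :
    SmoothVFAt I X x ↔
      ContMDiffAt I 𝓘(ℝ, E) ∞ (fun y => chartVF I X x (extChartAt I x y)) x := by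
  refine (Bundle.contMDiffAt_section (F := E) (E := fun x : M => TangentSpace I x) x).trans ?_
  have heq : ∀ y ∈ (chartAt H x).source,
      (trivializationAt E (fun x : M => TangentSpace I x) x (TotalSpace.mk' E y (X y))).2 =
        chartVF I X x (extChartAt I x y) := by
    intro y hy
    have hy' : y ∈ (extChartAt I x).source := by rwa [extChartAt_source]
    have h1 : (trivializationAt E (fun x : M => TangentSpace I x) x (TotalSpace.mk' E y (X y))).2 =
        (trivializationAt E (TangentSpace I) x).continuousLinearMapAt ℝ y (X y) := by
      rw [Bundle.Trivialization.continuousLinearMapAt_apply,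
        Bundle.Trivialization.coe_linearMapAt_of_mem]
      simpa using hy
    rw [h1, TangentBundle.continuousLinearMapAt_trivializationAt hy]
    refine (chartVF_eq_of_chartSymmDeriv ((extChartAt I x).map_source hy') ?_).symm
    rw [(extChartAt I x).left_inv hy']
    have := mfderivWithin_extChartAt_symm_comp_mfderiv_extChartAt' (I := I) hy'
    exact DFunLike.congr_fun this (X y)
  have hn : (chartAt H x).source ∈ 𝓝 x := chart_source_mem_nhds H x
  exact ⟨fun h => h.congr_of_eventuallyEq (Filter.eventually_of_mem hn fun y hy => (heq y hy).symm),
    fun h => h.congr_of_eventuallyEq (Filter.eventually_of_mem hn fun y hy => heq y hy)⟩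

end ChartDeriv

/-! ### Charts of a product manifold -/

section ProductCharts
variable {ι : Type*} [Fintype ι] {E : ι → Type*} [∀ i, NormedAddCommGroup (E i)]
  [∀ i, NormedSpace ℝ (E i)] {H : ι → Type*} [∀ i, TopologicalSpace (H i)]
  (I : ∀ i, ModelWithCorners ℝ (E i) (H i))
  {M : ι → Type*} [∀ i, TopologicalSpace (M i)] [∀ i, ChartedSpace (H i) (M i)]

theorem extChartAt_pi_apply (p q : ∀ i, M i) (i : ι) :
    extChartAt (ModelWithCorners.pi I) p q i = extChartAt (I i) (p i) (q i) := rfl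

theorem extChartAt_pi_symm_apply (p : ∀ i, M i) (y : ∀ i, E i) (i : ι) :
    (extChartAt (ModelWithCorners.pi I) p).symm y i = (extChartAt (I i) (p i)).symm (y i) := rfl

theorem mem_extChartAt_pi_target [∀ i, (I i).Boundaryless] {p : ∀ i, M i} {y : ∀ i, E i} :
    y ∈ (extChartAt (ModelWithCorners.pi I) p).target ↔
      ∀ i, y i ∈ (extChartAt (I i) (p i)).target := by
  simp only [extChartAt_target, ModelWithCorners.range_eq_univ, inter_univ]
  exact ⟨fun h i => h i trivial, fun h i _ => h i⟩

/-- The derivative of the identity is the tuple of the projections, and `hasMFDerivWithinAt_pi`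
reads off its components. -/
theorem hasMFDerivAt_eval (i : ι) (p : ∀ i, M i) :
    HasMFDerivAt (ModelWithCorners.pi I) (I i) (fun q => q i) p
      (ContinuousLinearMap.proj (R := ℝ) (φ := fun i => TangentSpace (I i) (p i)) i) := by
  have h : HasMFDerivWithinAt (ModelWithCorners.pi I) (ModelWithCorners.pi I) id univ p
      (ContinuousLinearMap.pi (φ := fun i => TangentSpace (I i) (p i)) fun i =>
        ContinuousLinearMap.proj (R := ℝ) (φ := fun i => TangentSpace (I i) (p i)) i) :=
    hasMFDerivWithinAt_id univ p
  exact hasMFDerivWithinAt_univ.1 (hasMFDerivWithinAt_pi.1 h i)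

theorem contMDiff_eval (i : ι) :
    ContMDiff (ModelWithCorners.pi I) (I i) ∞ (fun p : ∀ i, M i => p i) := fun p =>
  contMDiffWithinAt_univ.1 (contMDiffWithinAt_pi.1 (contMDiffWithinAt_id (s := univ) (x := p)) i)

theorem mfderiv_eval (i : ι) (p : ∀ i, M i) :
    mfderiv (ModelWithCorners.pi I) (I i) (fun q : ∀ i, M i => q i) p =
      ContinuousLinearMap.proj (R := ℝ) (φ := fun i => TangentSpace (I i) (p i)) i :=
  (hasMFDerivAt_eval I i p).mfderiv

variable [∀ i, IsManifold (I i) ∞ (M i)] [∀ i, (I i).Boundaryless]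

/-- The chain rule gives two expressions for the derivative of the `i`-th coordinate of the inverse
chart; derivatives are unique. -/
theorem chartSymmDeriv_pi {p : ∀ i, M i} {y : ∀ i, E i}
    (hy : ∀ i, y i ∈ (extChartAt (I i) (p i)).target) (v : ∀ i, E i) (i : ι) :
    chartSymmDeriv (ModelWithCorners.pi I) p y v i = chartSymmDeriv (I i) (p i) (y i) (v i) := by
  have h1 := hasMFDerivAt_extChartAt_symm ((mem_extChartAt_pi_target I).2 hy)
  have h2 := (hasMFDerivAt_eval I i _).comp y h1
  have h3 : HasMFDerivAt 𝓘(ℝ, ∀ i, E i) 𝓘(ℝ, E i) (fun z : ∀ i, E i => z i) y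
      (ContinuousLinearMap.proj (R := ℝ) (φ := E) i) :=
    (ContinuousLinearMap.proj (R := ℝ) (φ := E) i).hasMFDerivAt
  have h4 := (hasMFDerivAt_extChartAt_symm (I := I i) (hy i)).comp y h3
  exact DFunLike.congr_fun (hasMFDerivAt_unique h2 h4) v

end ProductCharts

/-! ### The Dorfman bracket in a chart -/

section ChartSection
variable {E : Type*} [NormedAddCommGroup E] [NormedSpace ℝ E]

/-- Twice the symmetric pairing on `E ⊕ E*`. -/
def modelPairing (a b : E × (E →L[ℝ] ℝ)) : ℝ := a.2 b.1 + b.2 a.1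

theorem modelPairing_sub_left (a a' b : E × (E →L[ℝ] ℝ)) :
    modelPairing (a - a') b = modelPairing a b - modelPairing a' b := by
  simp only [modelPairing, Prod.fst_sub, Prod.snd_sub, map_sub, sub_apply]
  ring

variable {H : Type*} [TopologicalSpace H]
  {I : ModelWithCorners ℝ E H} {M : Type*} [TopologicalSpace M] [ChartedSpace H M]

variable (I) in
/-- A section of the generalized tangent bundle read in the preferred chart at `x`. -/
def chartSection (e : ∀ x : M, GenTangent I x) (x : M) (y : E) : E × (E →L[ℝ] ℝ) :=
  (chartVF I (fun z => (e z).1) x y, chartOneForm I (fun z => (e z).2) x y)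

variable (I) in
/-- A section of the generalized tangent bundle at `x`, as an element of `E ⊕ E*`. -/
def modelValue {x : M} (e : GenTangent I x) : E × (E →L[ℝ] ℝ) := e

variable [I.Boundaryless] [FiniteDimensional ℝ E] [IsManifold I ∞ M]

theorem differentiableAt_chartSection {e : ∀ x : M, GenTangent I x} {x : M}
    (he : SmoothSectionAt I e x) :
    DifferentiableAt ℝ (chartSection I e x) (extChartAt I x x) :=
  (differentiableAt_chartVF' he.1).prodMk (differentiableAt_chartOneForm he.2)

theorem fderiv_chartSection {e : ∀ x : M, GenTangent I x} {x : M}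
    (he : SmoothSectionAt I e x) (v : E) :
    fderiv ℝ (chartSection I e x) (extChartAt I x x) v =
      (fderiv ℝ (chartVF I (fun z => (e z).1) x) (extChartAt I x x) v,
        fderiv ℝ (chartOneForm I (fun z => (e z).2) x) (extChartAt I x x) v) := by
  unfold chartSection
  rw [(differentiableAt_chartVF' he.1).fderiv_prodMk (differentiableAt_chartOneForm he.2)]
  rfl

/-- In `d(β(X)) + ι_X dβ` the two terms `(D_w β)(X)` cancel. The remaining `β(D_w X)` joins `(D_w
α)(Y)` from `-ι_Y dα` to form the last pairing. Each term of the result pairs one derivative of a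
section with one value, which is what allows a splitting over the factors. -/
theorem modelPairing_dorfman {e e' : ∀ x : M, GenTangent I x} {x : M}
    (he : SmoothSectionAt I e x) (he' : SmoothSectionAt I e' x) (w : E × (E →L[ℝ] ℝ)) :
    modelPairing (modelValue I (dorfman I e e' x)) w =
      modelPairing (fderiv ℝ (chartSection I e' x) (extChartAt I x x) (modelValue I (e x)).1) w -
      modelPairing (fderiv ℝ (chartSection I e x) (extChartAt I x x) (modelValue I (e' x)).1) w +
      modelPairing (fderiv ℝ (chartSection I e x) (extChartAt I x x) w.1)
        (modelValue I (e' x)) := by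
  rw [fderiv_chartSection he', fderiv_chartSection he, fderiv_chartSection he]
  have h1 : (modelValue I (dorfman I e e' x)).1 =
      fderiv ℝ (chartVF I (fun z => (e' z).1) x) (extChartAt I x x) (modelValue I (e x)).1 -
      fderiv ℝ (chartVF I (fun z => (e z).1) x) (extChartAt I x x) (modelValue I (e' x)).1 :=
    mlieBracket_coord _ _ x
  have h2 : (modelValue I (dorfman I e e' x)).2 w.1 =
      mvfderiv I (fun y => (e' y).2 (e y).1) x w.1 +
        interiorExtDeriv I (fun y => (e' y).2) x (e x).1 w.1 -
        interiorExtDeriv I (fun y => (e y).2) x (e' x).1 w.1 := rfl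
  have h3 : mvfderiv I (fun y => (e' y).2 (e y).1) x w.1 =
      fderiv ℝ (chartOneForm I (fun z => (e' z).2) x) (extChartAt I x x) w.1 (modelValue I (e x)).1 +
      (modelValue I (e' x)).2 (fderiv ℝ (chartVF I (fun z => (e z).1) x) (extChartAt I x x) w.1) :=
    pairing_deriv he'.2 he.1 w.1
  have h4 : interiorExtDeriv I (fun y => (e' y).2) x (e x).1 w.1 =
      fderiv ℝ (chartOneForm I (fun z => (e' z).2) x) (extChartAt I x x)
        (modelValue I (e x)).1 w.1 -
      fderiv ℝ (chartOneForm I (fun z => (e' z).2) x) (extChartAt I x x) w.1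
        (modelValue I (e x)).1 := interiorExtDeriv_apply _ x _ _
  have h5 : interiorExtDeriv I (fun y => (e y).2) x (e' x).1 w.1 =
      fderiv ℝ (chartOneForm I (fun z => (e z).2) x) (extChartAt I x x)
        (modelValue I (e' x)).1 w.1 -
      fderiv ℝ (chartOneForm I (fun z => (e z).2) x) (extChartAt I x x) w.1
        (modelValue I (e' x)).1 := interiorExtDeriv_apply _ x _ _
  rw [h3, h4, h5] at h2
  unfold modelPairing
  rw [h1, h2, map_sub]
  ring

end ChartSection

/-! ### Maximal isotropic subspaces -/

section ModelFiber
variable {E : Type*} [NormedAddCommGroup E] [NormedSpace ℝ E] {H : Type*} [TopologicalSpace H]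
  {I : ModelWithCorners ℝ E H} {M : Type*} [TopologicalSpace M] [ChartedSpace H M]

/-- An element of `E ⊕ E*` that is orthogonal to a maximal isotropic subspace lies in it. -/
theorem mem_of_maximal_isotropic [FiniteDimensional ℝ E] {x : M}
    {W : Submodule ℝ (GenTangent I x)} (hW : Maximal (IsIsotropic I) W)
    {e : GenTangent I x} (he : ∀ f ∈ W, genPairing I e f = 0) : e ∈ W := by
  -- A null vector orthogonal to `W` can be adjoined to `W` without losing isotropy.
  have key : ∀ e : GenTangent I x, e.2 e.1 = 0 → (∀ f ∈ W, genPairing I e f = 0) → e ∈ W := by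
    intro e h0 he
    refine hW.2 (y := W ⊔ Submodule.span ℝ {e}) ?_ le_sup_left
      (Submodule.mem_sup_right (Submodule.mem_span_singleton_self e))
    intro a ha b hb
    obtain ⟨u, hu, _, hu', rfl⟩ := Submodule.mem_sup.1 ha
    obtain ⟨v, hv, _, hv', rfl⟩ := Submodule.mem_sup.1 hb
    obtain ⟨r, rfl⟩ := Submodule.mem_span_singleton.1 hu'
    obtain ⟨s, rfl⟩ := Submodule.mem_span_singleton.1 hv'
    have h1 := hW.1 u hu v hv
    have h2 := he u hu
    have h3 := he v hv
    simp only [genPairing, Prod.fst_add, Prod.snd_add, Prod.smul_fst, Prod.smul_snd, map_add,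
      map_smul, add_apply, smul_apply, smul_eq_mul] at *
    linear_combination h1 + s * h2 + r * h3 + r * s * h0
  -- The difference of two elements with the same vector part is a pure covector, hence null.
  have key0 : ∀ e : GenTangent I x, (∀ f ∈ W, genPairing I e f = 0) → ∀ β,
      ((e.1, β) : GenTangent I x) ∈ W → e ∈ W := by
    intro e he β hβ
    have h1 : e - (e.1, β) ∈ W := by
      refine key _ (by simp) fun f hf => ?_
      have h2 := he f hf
      have h3 := hW.1 _ hβ f hf
      simp only [genPairing, Prod.fst_sub, Prod.snd_sub, map_sub, sub_apply] at *
      linear_combination h2 - h3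
    simpa using W.add_mem h1 hβ
  by_contra hc
  have hn : e.1 ∉ W.map (LinearMap.fst ℝ (TangentSpace I x) (TangentSpace I x →L[ℝ] ℝ)) := by
    rintro ⟨⟨v, β⟩, hβ, h : v = e.1⟩
    subst h
    exact hc (key0 e he β hβ)
  -- Here `e.1` lies outside the projection of `W` to vectors. A multiple of a functional `η` that
  -- annihilates this projection can be added to `e.2` without affecting orthogonality to `W`; the
  -- factor in `γ` makes the sum null, so `key` puts it in `W` and `key0` gives the contradiction.
  obtain ⟨η, h1, h2⟩ := Submodule.exists_dual_map_eq_bot_of_notMem hn inferInstance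
  have : FiniteDimensional ℝ (TangentSpace I x) := inferInstanceAs (FiniteDimensional ℝ E)
  have : T2Space (TangentSpace I x) := inferInstanceAs (T2Space E)
  let γ : TangentSpace I x →L[ℝ] ℝ := (-(e.2 e.1) / η e.1) • LinearMap.toContinuousLinearMap η
  have hγ : ∀ v, γ v = -(e.2 e.1) / η e.1 * η v := fun v => rfl
  have hz : ∀ f ∈ W, η f.1 = 0 := fun f hf => by
    have : η f.1 ∈ (W.map (LinearMap.fst ℝ (TangentSpace I x) (TangentSpace I x →L[ℝ] ℝ))).map η :=
      ⟨f.1, ⟨f, hf, rfl⟩, rfl⟩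
    rwa [h2] at this
  have h3 : ((e.1, e.2 + γ) : GenTangent I x) ∈ W := by
    refine key _ ?_ fun f hf => ?_
    · rw [add_apply, hγ]
      field_simp
      ring
    · have := he f hf
      simp only [genPairing, add_apply, hγ, hz f hf] at *
      linear_combination this
  exact hc (key0 e he _ h3)

variable [IsManifold I ∞ M]

/-- The fibre at `x` of a Dirac structure, as a subspace of `E ⊕ E*`. -/
def DiracStructure.modelFiber (D : DiracStructure I M) (x : M) : Submodule ℝ (E × (E →L[ℝ] ℝ)) :=
  D.L x

theorem DiracStructure.modelPairing_eq_zero (D : DiracStructure I M) {x : M}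
    {a b : E × (E →L[ℝ] ℝ)} (ha : a ∈ D.modelFiber x) (hb : b ∈ D.modelFiber x) :
    modelPairing a b = 0 := by
  have h : (a.2 b.1 + b.2 a.1) / 2 = 0 := (D.maximal_isotropic x).1 a ha b hb
  unfold modelPairing
  linarith

end ModelFiber

/-- The difference quotients lie in `W`, which is closed because the dimension is finite. -/
theorem HasDerivAt.mem_submodule {F : Type*} [NormedAddCommGroup F] [NormedSpace ℝ F]
    [FiniteDimensional ℝ F] (W : Submodule ℝ F) {f : ℝ → F} {f' : F} {t : ℝ}
    (hf : HasDerivAt f f' t) (hW : ∀ᶠ s in 𝓝 t, f s ∈ W) : f' ∈ W := by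
  refine W.closed_of_finiteDimensional.mem_of_tendsto (hasDerivAt_iff_tendsto_slope.1 hf) ?_
  filter_upwards [hW.filter_mono nhdsWithin_le_nhds] with s hs
  exact W.smul_mem _ (W.sub_mem hs hW.self_of_nhds)

/-! ### Linear algebra of the product fibre -/

section ProductFiber
variable {ι : Type*} [Fintype ι] [DecidableEq ι] {E : ι → Type*} [∀ i, NormedAddCommGroup (E i)]
  [∀ i, NormedSpace ℝ (E i)]

variable (E) in
/-- The component in `E i ⊕ (E i)*` of an element of `(∏ E i) ⊕ (∏ E i)*`. -/
def prodComponent (i : ι) :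
    (∀ i, E i) × ((∀ i, E i) →L[ℝ] ℝ) →L[ℝ] E i × (E i →L[ℝ] ℝ) :=
  ((ContinuousLinearMap.proj (R := ℝ) (φ := E) i).comp (ContinuousLinearMap.fst ℝ _ _)).prod
    (((ContinuousLinearMap.compL ℝ (E i) (∀ i, E i) ℝ).flip
      (ContinuousLinearMap.single ℝ E i)).comp (ContinuousLinearMap.snd ℝ _ _))

theorem prodComponent_fst (i : ι) (a : (∀ i, E i) × ((∀ i, E i) →L[ℝ] ℝ)) :
    (prodComponent E i a).1 = a.1 i := rfl

theorem prodComponent_snd_apply (i : ι) (a : (∀ i, E i) × ((∀ i, E i) →L[ℝ] ℝ)) (v : E i) :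
    (prodComponent E i a).2 v = a.2 (Pi.single i v) := rfl

theorem apply_eq_sum_single (α : (∀ i, E i) →L[ℝ] ℝ) (v : ∀ i, E i) :
    α v = ∑ i, α (Pi.single i (v i)) := by
  rw [← map_sum, Finset.univ_sum_single]

theorem sum_comp_proj_single (β : ∀ i, E i →L[ℝ] ℝ) (i : ι) (v : E i) :
    (∑ j, β j ∘L ContinuousLinearMap.proj (R := ℝ) (φ := E) j) (Pi.single i v) = β i v := by
  rw [sum_apply, Finset.sum_eq_single i]
  · simp
  · intro j _ hj
    simp [hj]
  · simp

theorem modelPairing_eq_sum (a b : (∀ i, E i) × ((∀ i, E i) →L[ℝ] ℝ)) :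
    modelPairing a b = ∑ i, modelPairing (prodComponent E i a) (prodComponent E i b) := by
  simp only [modelPairing, prodComponent_snd_apply, prodComponent_fst, Finset.sum_add_distrib]
  rw [← apply_eq_sum_single, ← apply_eq_sum_single]

/-- The inclusion of `E i ⊕ (E i)*` in `(∏ E i) ⊕ (∏ E i)*`. -/
def prodInclusion (i : ι) :
    E i × (E i →L[ℝ] ℝ) →L[ℝ] (∀ i, E i) × ((∀ i, E i) →L[ℝ] ℝ) :=
  ((ContinuousLinearMap.single ℝ E i).comp (ContinuousLinearMap.fst ℝ _ _)).prod
    (((ContinuousLinearMap.compL ℝ (∀ i, E i) (E i) ℝ).flip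
      (ContinuousLinearMap.proj (R := ℝ) (φ := E) i)).comp (ContinuousLinearMap.snd ℝ _ _))

theorem prodInclusion_fst (i : ι) (a : E i × (E i →L[ℝ] ℝ)) :
    (prodInclusion i a).1 = Pi.single i a.1 := rfl

theorem prodInclusion_snd_apply (i : ι) (a : E i × (E i →L[ℝ] ℝ)) (v : ∀ i, E i) :
    (prodInclusion i a).2 v = a.2 (v i) := rfl

theorem prodComponent_prodInclusion_self (i : ι) (a : E i × (E i →L[ℝ] ℝ)) :
    prodComponent E i (prodInclusion i a) = a := by
  refine Prod.ext (by simp [prodComponent_fst, prodInclusion_fst]) ?_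
  ext v
  simp [prodComponent_snd_apply, prodInclusion_snd_apply]

theorem prodComponent_prodInclusion_of_ne {i j : ι} (h : j ≠ i) (a : E i × (E i →L[ℝ] ℝ)) :
    prodComponent E j (prodInclusion i a) = 0 := by
  refine Prod.ext (by simp [prodComponent_fst, prodInclusion_fst, h]) ?_
  ext v
  simp [prodComponent_snd_apply, prodInclusion_snd_apply, h.symm]

theorem sum_prodInclusion (a : (∀ i, E i) × ((∀ i, E i) →L[ℝ] ℝ)) :
    ∑ i, prodInclusion i (prodComponent E i a) = a := by
  refine Prod.ext ?_ ?_
  · rw [Prod.fst_sum]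
    exact Finset.univ_sum_single a.1
  · rw [Prod.snd_sum]
    ext v
    rw [apply_eq_sum_single a.2 v]
    simp [prodInclusion_snd_apply, prodComponent_snd_apply]

/-- Taking the component in one factor kills the terms of all the others, which leaves a relation
within that factor. -/
theorem linearIndependent_prodInclusion {r : ι → Type*} [∀ i, Fintype (r i)]
    {s : ∀ i, r i → E i × (E i →L[ℝ] ℝ)} (hs : ∀ i, LinearIndependent ℝ (s i)) :
    LinearIndependent ℝ fun k : Σ i, r i => prodInclusion k.1 (s k.1 k.2) := by
  refine Fintype.linearIndependent_iff.2 fun c hc k => ?_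
  refine Fintype.linearIndependent_iff.1 (hs k.1) (fun j => c ⟨k.1, j⟩) ?_ k.2
  have h := congrArg (prodComponent E k.1) hc
  rw [map_sum, map_zero, Fintype.sum_sigma, Finset.sum_eq_single k.1] at h
  · simpa only [map_smul, prodComponent_prodInclusion_self] using h
  · intro i _ hi
    simp only [map_smul, prodComponent_prodInclusion_of_ne hi.symm, smul_zero,
      Finset.sum_const_zero]
  · simp

theorem mem_span_prodInclusion {r : ι → Type*} {s : ∀ i, r i → E i × (E i →L[ℝ] ℝ)}
    {a : (∀ i, E i) × ((∀ i, E i) →L[ℝ] ℝ)}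
    (ha : ∀ i, prodComponent E i a ∈ Submodule.span ℝ (range (s i))) :
    a ∈ Submodule.span ℝ (range fun k : Σ i, r i => prodInclusion k.1 (s k.1 k.2)) := by
  rw [← sum_prodInclusion a]
  refine Submodule.sum_mem _ fun i _ => ?_
  have h : Submodule.span ℝ (range (s i)) ≤ (Submodule.span ℝ
      (range fun k : Σ i, r i => prodInclusion k.1 (s k.1 k.2))).comap
        (prodInclusion i).toLinearMap := by
    refine Submodule.span_le.2 ?_
    rintro _ ⟨j, rfl⟩
    exact Submodule.subset_span ⟨⟨i, j⟩, rfl⟩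
  exact h (ha i)

variable {H : ι → Type*} [∀ i, TopologicalSpace (H i)]
  {I : ∀ i, ModelWithCorners ℝ (E i) (H i)}
  {M : ι → Type*} [∀ i, TopologicalSpace (M i)] [∀ i, ChartedSpace (H i) (M i)]
  [∀ i, IsManifold (I i) ∞ (M i)]

/-- The family `β` in `prodDirac` is forced: `β i` is the restriction of the covector to the `i`-th
factor, because the derivative of an evaluation is a projection. -/
theorem mem_prodDirac {D : ∀ i, DiracStructure (I i) (M i)} {p : ∀ i, M i}
    {e : GenTangent (ModelWithCorners.pi I) p} :
    e ∈ prodDirac D p ↔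
      ∀ i, prodComponent E i (modelValue (ModelWithCorners.pi I) e) ∈
        (D i).modelFiber (p i) := by
  constructor
  · rintro ⟨β, hβ, he⟩ i
    have h := hβ i
    rw [mfderiv_eval] at h
    have h2 : (prodComponent E i (modelValue (ModelWithCorners.pi I) e)).2 = β i := by
      ext v
      have h3 : (modelValue (ModelWithCorners.pi I) e).2 =
          ∑ i, (β i : E i →L[ℝ] ℝ) ∘L ContinuousLinearMap.proj (R := ℝ) (φ := E) i :=
        he.trans (by simp only [mfderiv_eval]; rfl)
      rw [prodComponent_snd_apply, h3]
      exact sum_comp_proj_single (E := E) β i v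
    have h3 : prodComponent E i (modelValue (ModelWithCorners.pi I) e) = ((e.1 : ∀ i, E i) i, β i) :=
      Prod.ext rfl h2
    rw [h3]
    exact h
  · intro h
    refine ⟨fun i => (prodComponent E i (modelValue (ModelWithCorners.pi I) e)).2, fun i => ?_, ?_⟩
    · rw [mfderiv_eval]
      exact h i
    · simp only [mfderiv_eval]
      exact (congrArg Prod.snd (sum_prodInclusion (modelValue (ModelWithCorners.pi I) e))).symm.trans
        (Prod.snd_sum)

theorem prodInclusion_mem_prodDirac {D : ∀ i, DiracStructure (I i) (M i)} {p : ∀ i, M i} {i : ι}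
    {a : E i × (E i →L[ℝ] ℝ)} (ha : a ∈ (D i).modelFiber (p i)) :
    (prodInclusion i a : GenTangent (ModelWithCorners.pi I) p) ∈ prodDirac D p := by
  refine mem_prodDirac.2 fun j => ?_
  by_cases h : j = i
  · subst h
    have := prodComponent_prodInclusion_self j a
    exact this.symm ▸ ha
  · have := prodComponent_prodInclusion_of_ne h a
    exact this.symm ▸ Submodule.zero_mem _

theorem isIsotropic_iff {E : Type*} [NormedAddCommGroup E] [NormedSpace ℝ E] {H : Type*}
    [TopologicalSpace H] {I : ModelWithCorners ℝ E H} {M : Type*} [TopologicalSpace M]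
    [ChartedSpace H M] {x : M} {W : Submodule ℝ (GenTangent I x)} : IsIsotropic I W ↔
      ∀ e ∈ W, ∀ f ∈ W, modelPairing (modelValue I e) (modelValue I f) = 0 :=
  forall₄_congr fun _ _ _ _ => div_eq_zero_iff.trans (or_iff_left two_ne_zero)

theorem maximal_isIsotropic_prodDirac [∀ i, FiniteDimensional ℝ (E i)]
    (D : ∀ i, DiracStructure (I i) (M i)) (p : ∀ i, M i) :
    Maximal (IsIsotropic (ModelWithCorners.pi I)) (prodDirac D p) := by
  refine ⟨isIsotropic_iff.2 fun e he f hf => ?_, fun W hW hle e he => mem_prodDirac.2 fun i => ?_⟩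
  · rw [modelPairing_eq_sum]
    exact Finset.sum_eq_zero fun i _ =>
      (D i).modelPairing_eq_zero (mem_prodDirac.1 he i) (mem_prodDirac.1 hf i)
  · refine mem_of_maximal_isotropic ((D i).maximal_isotropic (p i)) fun f hf => ?_
    -- By definition, pairing `e` with the inclusion of `f` is pairing the `i`-th component of `e`
    -- with `f`.
    have h := isIsotropic_iff.1 hW e he _ (hle (prodInclusion_mem_prodDirac hf))
    exact div_eq_zero_iff.2 (Or.inl h)

end ProductFiber

/-! ### Sections of the generalized tangent bundle in a chart -/

section ChartPullback
variable {E : Type*} [NormedAddCommGroup E] [NormedSpace ℝ E] {H : Type*} [TopologicalSpace H]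
  (I : ModelWithCorners ℝ E H) {M : Type*} [TopologicalSpace M] [ChartedSpace H M]

/-- The pullback of an element of the fibre of the generalized tangent bundle by the inverse of the
preferred chart at `x`. -/
def chartPullback (x : M) (y : E) (a : E × (E →L[ℝ] ℝ)) : E × (E →L[ℝ] ℝ) :=
  ((chartSymmDeriv I x y).inverse a.1, a.2 ∘L chartSymmDeriv I x y)

theorem chartSection_eq (e : ∀ x : M, GenTangent I x) (x : M) (y : E) :
    chartSection I e x y = chartPullback I x y (modelValue I (e ((extChartAt I x).symm y))) := rfl

theorem chartPullback_zero (x : M) (y : E) : chartPullback I x y 0 = 0 :=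
  Prod.ext (map_zero _) (ContinuousLinearMap.zero_comp _)

variable {I} [IsManifold I ∞ M]

theorem chartPullback_self (x : M) (a : E × (E →L[ℝ] ℝ)) :
    chartPullback I x (extChartAt I x x) a = a := by
  unfold chartPullback
  rw [chartSymmDeriv_self, ContinuousLinearMap.inverse_id]
  rfl

variable [I.Boundaryless]

theorem smoothSectionAt_iff {e : ∀ x : M, GenTangent I x} {x : M} :
    SmoothSectionAt I e x ↔ ContMDiffAt I 𝓘(ℝ, E × (E →L[ℝ] ℝ)) ∞
      (fun y => chartSection I e x (extChartAt I x y)) x := by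
  rw [contMDiffAt_prod_module_iff]
  exact and_congr vfAt_iff oneFormAt_iff

end ChartPullback

/-! ### Slices and lifts of sections -/

section SliceLift
variable {ι : Type*} [Fintype ι] [DecidableEq ι] {E : ι → Type*} [∀ i, NormedAddCommGroup (E i)]
  [∀ i, NormedSpace ℝ (E i)] {H : ι → Type*} [∀ i, TopologicalSpace (H i)]
  {I : ∀ i, ModelWithCorners ℝ (E i) (H i)}
  {M : ι → Type*} [∀ i, TopologicalSpace (M i)] [∀ i, ChartedSpace (H i) (M i)]

/-- The `i`-th component of a section over the product, restricted to the slice through `p` in the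
`i`-th direction. -/
def sliceSection (e : ∀ p : (∀ i, M i), GenTangent (ModelWithCorners.pi I) p) (p : ∀ i, M i) (i : ι)
    (q : M i) : GenTangent (I i) q :=
  prodComponent E i (modelValue (ModelWithCorners.pi I) (e (Function.update p i q)))

/-- The section over the product given by a section over the `i`-th factor. -/
def liftSection (i : ι) (s : ∀ q : M i, GenTangent (I i) q) (p : ∀ i, M i) :
    GenTangent (ModelWithCorners.pi I) p :=
  prodInclusion i (modelValue (I i) (s (p i)))

theorem extChartAt_pi_symm_update (p : ∀ i, M i) (i : ι) (z : E i) :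
    (extChartAt (ModelWithCorners.pi I) p).symm
      (Function.update (extChartAt (ModelWithCorners.pi I) p p) i z) =
      Function.update p i ((extChartAt (I i) (p i)).symm z) := by
  funext j
  rw [extChartAt_pi_symm_apply]
  by_cases h : j = i
  · subst h
    simp
  · simp only [Function.update_of_ne h]
    exact extChartAt_to_inv _

theorem extChartAt_pi_update (p : ∀ i, M i) (i : ι) (q : M i) :
    extChartAt (ModelWithCorners.pi I) p (Function.update p i q) =
      Function.update (extChartAt (ModelWithCorners.pi I) p p) i (extChartAt (I i) (p i) q) := by
  funext j
  rw [extChartAt_pi_apply]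
  by_cases h : j = i
  · subst h
    simp
  · simp only [Function.update_of_ne h]
    rfl

theorem update_mem_target {p : ∀ i, M i} {i : ι} {z : E i}
    (hz : z ∈ (extChartAt (I i) (p i)).target) (j : ι) :
    Function.update (extChartAt (ModelWithCorners.pi I) p p) i z j ∈
      (extChartAt (I j) (p j)).target := by
  by_cases h : j = i
  · subst h
    simpa using hz
  · simp only [Function.update_of_ne h]
    exact mem_extChartAt_target _

theorem contMDiff_update (p : ∀ i, M i) (i : ι) :
    ContMDiff (I i) (ModelWithCorners.pi I) ∞ (fun q : M i => Function.update p i q) := by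
  intro q
  rw [← contMDiffWithinAt_univ, contMDiffWithinAt_pi]
  intro j
  by_cases h : j = i
  · subst h
    simp only [Function.update_self]
    exact contMDiffWithinAt_id
  · simpa only [Function.update_of_ne h] using contMDiffWithinAt_const

variable [∀ i, IsManifold (I i) ∞ (M i)] [∀ i, (I i).Boundaryless]

/-- The derivative of the product chart is block diagonal, and so are its inverse and its transpose.
-/
theorem prodComponent_chartPullback {p : ∀ i, M i} {y : ∀ i, E i}
    (hy : ∀ i, y i ∈ (extChartAt (I i) (p i)).target)
    (a : (∀ i, E i) × ((∀ i, E i) →L[ℝ] ℝ)) (i : ι) :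
    prodComponent E i (chartPullback (ModelWithCorners.pi I) p y a) =
      chartPullback (I i) (p i) (y i) (prodComponent E i a) := by
  have hy' := (mem_extChartAt_pi_target I).2 hy
  refine Prod.ext ?_ ?_
  · show (chartSymmDeriv (ModelWithCorners.pi I) p y).inverse a.1 i =
      (chartSymmDeriv (I i) (p i) (y i)).inverse (a.1 i)
    have h1 := chartSymmDeriv_pi I hy ((chartSymmDeriv (ModelWithCorners.pi I) p y).inverse a.1) i
    rw [(isInvertible_chartSymmDeriv hy').self_apply_inverse] at h1
    rw [h1, (isInvertible_chartSymmDeriv (hy i)).inverse_apply_self]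
  · ext v
    show a.2 (chartSymmDeriv (ModelWithCorners.pi I) p y (Pi.single i v)) =
      a.2 (Pi.single i (chartSymmDeriv (I i) (p i) (y i) v))
    congr 1
    funext j
    rw [chartSymmDeriv_pi I hy]
    by_cases h : j = i
    · subst h
      simp
    · simp [h]

theorem chartSection_sliceSection (e : ∀ p : (∀ i, M i), GenTangent (ModelWithCorners.pi I) p)
    (p : ∀ i, M i) (i : ι) {z : E i} (hz : z ∈ (extChartAt (I i) (p i)).target) :
    chartSection (I i) (sliceSection e p i) (p i) z = prodComponent E i
      (chartSection (ModelWithCorners.pi I) e p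
        (Function.update (extChartAt (ModelWithCorners.pi I) p p) i z)) := by
  rw [chartSection_eq, chartSection_eq, prodComponent_chartPullback (update_mem_target hz),
    Function.update_self, extChartAt_pi_symm_update]
  rfl

theorem chartSection_liftSection (i : ι) (s : ∀ q : M i, GenTangent (I i) q) {p : ∀ i, M i}
    {y : ∀ i, E i} (hy : ∀ i, y i ∈ (extChartAt (I i) (p i)).target) :
    chartSection (ModelWithCorners.pi I) (liftSection i s) p y =
      prodInclusion i (chartSection (I i) s (p i) (y i)) := by
  rw [← sum_prodInclusion (chartSection (ModelWithCorners.pi I) (liftSection i s) p y),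
    chartSection_eq]
  have h : ∀ j, prodComponent E j (chartPullback (ModelWithCorners.pi I) p y
      (modelValue (ModelWithCorners.pi I)
        (liftSection i s ((extChartAt (ModelWithCorners.pi I) p).symm y)))) =
      chartPullback (I j) (p j) (y j) (prodComponent E j (prodInclusion i
        (modelValue (I i) (s ((extChartAt (I i) (p i)).symm (y i)))))) := fun j =>
    prodComponent_chartPullback hy _ j
  simp only [h]
  rw [Finset.sum_eq_single i]
  · rw [prodComponent_prodInclusion_self]
    rfl
  · intro j _ hj
    rw [prodComponent_prodInclusion_of_ne hj, chartPullback_zero, map_zero]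
  · simp

theorem smoothSectionAt_liftSection {i : ι} {s : ∀ q : M i, GenTangent (I i) q} {p : ∀ i, M i}
    (hs : SmoothSectionAt (I i) s (p i)) :
    SmoothSectionAt (ModelWithCorners.pi I) (liftSection i s) p := by
  rw [smoothSectionAt_iff] at *
  have h1 := hs.comp p (contMDiff_eval I i p)
  have h2 := (prodInclusion (E := E) i).contMDiff.contMDiffAt.comp p h1
  refine h2.congr_of_eventuallyEq ?_
  filter_upwards [extChartAt_source_mem_nhds (I := ModelWithCorners.pi I) p] with q hq
  exact chartSection_liftSection i s
    ((mem_extChartAt_pi_target I).1 ((extChartAt (ModelWithCorners.pi I) p).map_source hq))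

theorem smoothSectionAt_sliceSection
    {e : ∀ p : (∀ i, M i), GenTangent (ModelWithCorners.pi I) p}
    (he : ∀ p, SmoothSectionAt (ModelWithCorners.pi I) e p) (p : ∀ i, M i) (i : ι) (q : M i) :
    SmoothSectionAt (I i) (sliceSection e p i) q := by
  -- The charts are centred at `p`, so the claim is first shown at `q = p i`. Replacing `p i` by `q`
  -- in the base point does not change the slice, which gives the general case.
  have key : ∀ p : ∀ i, M i, SmoothSectionAt (I i) (sliceSection e p i) (p i) := by
    intro p
    -- The base point is written as an update so that it is literally the image of `p i` under the
    -- slice inclusion.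
    have h := he (Function.update p i (p i))
    rw [smoothSectionAt_iff] at *
    have h1 := h.comp (p i) (contMDiff_update p i (p i))
    have h2 := (prodComponent E i).contMDiff.contMDiffAt.comp (p i) h1
    refine h2.congr_of_eventuallyEq ?_
    filter_upwards [extChartAt_source_mem_nhds (I := I i) (p i)] with q hq
    rw [chartSection_sliceSection e p i ((extChartAt (I i) (p i)).map_source hq),
      ← extChartAt_pi_update]
    simp
  have h := key (Function.update p i q)
  rw [Function.update_self] at h
  have h2 : sliceSection e (Function.update p i q) i = sliceSection e p i := by
    funext z
    exact congrArg (fun r => prodComponent E i (show (∀ i, E i) × ((∀ i, E i) →L[ℝ] ℝ) from e r))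
      (Function.update_idem q z p)
  rwa [h2] at h

end SliceLift

/-! ### The product Dirac structure -/

section ProductDirac
variable {ι : Type*} [Fintype ι] [DecidableEq ι] {E : ι → Type*} [∀ i, NormedAddCommGroup (E i)]
  [∀ i, NormedSpace ℝ (E i)] {H : ι → Type*} [∀ i, TopologicalSpace (H i)]
  {I : ∀ i, ModelWithCorners ℝ (E i) (H i)}
  {M : ι → Type*} [∀ i, TopologicalSpace (M i)] [∀ i, ChartedSpace (H i) (M i)]
  [∀ i, IsManifold (I i) ∞ (M i)]

theorem sliceSection_mem {D : ∀ i, DiracStructure (I i) (M i)}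
    {e : ∀ p : (∀ i, M i), GenTangent (ModelWithCorners.pi I) p}
    (he : ∀ p, e p ∈ prodDirac D p) (p : ∀ i, M i) (i : ι) (q : M i) :
    sliceSection e p i q ∈ (D i).L q := by
  have h := mem_prodDirac.1 (he (Function.update p i q)) i
  rw [Function.update_self] at h
  exact h

variable [∀ i, (I i).Boundaryless]

theorem exists_frame_prodDirac (D : ∀ i, DiracStructure (I i) (M i)) (p : ∀ i, M i) :
    ∃ U : Set (∀ i, M i), IsOpen U ∧ p ∈ U ∧
      ∃ (r : ℕ) (s : Fin r → ∀ y : (∀ i, M i), GenTangent (ModelWithCorners.pi I) y),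
        (∀ j, ∀ y ∈ U, SmoothSectionAt (ModelWithCorners.pi I) (s j) y) ∧
        ∀ y ∈ U, LinearIndependent ℝ (fun j => s j y) ∧
          Submodule.span ℝ (range fun j => s j y) = prodDirac D y := by
  choose U hU hpU r s hs hLI using fun i => (D i).exists_frame (p i)
  let e : Fin (Fintype.card (Σ i, Fin (r i))) ≃ Σ i, Fin (r i) := (Fintype.equivFin _).symm
  refine ⟨Set.pi univ U, isOpen_set_pi finite_univ fun i _ => hU i, fun i _ => hpU i, _,
    fun j => liftSection (e j).1 (s (e j).1 (e j).2),
    fun j y hy => smoothSectionAt_liftSection (hs _ _ _ (hy _ trivial)), fun y hy => ⟨?_, ?_⟩⟩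
  · exact (linearIndependent_prodInclusion (E := E)
      (s := fun i j => modelValue (I i) (s i j (y i)))
      (fun i => (hLI i (y i) (hy i trivial)).1)).comp e e.injective
  · refine le_antisymm (Submodule.span_le.2 ?_) fun a ha => ?_
    · rintro _ ⟨j, rfl⟩
      refine prodInclusion_mem_prodDirac ?_
      have h : s (e j).1 (e j).2 (y (e j).1) ∈ (D (e j).1).L (y (e j).1) := by
        rw [← (hLI _ _ (hy _ trivial)).2]
        exact Submodule.subset_span ⟨_, rfl⟩
      exact h
    · have h := mem_span_prodInclusion (E := E)
        (s := fun i j => modelValue (I i) (s i j (y i)))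
        (a := modelValue (ModelWithCorners.pi I) a) fun i => by
          have := mem_prodDirac.1 ha i
          unfold DiracStructure.modelFiber at this
          rw [← (hLI i (y i) (hy i trivial)).2] at this
          exact this
      rw [← e.surjective.range_comp] at h
      exact h

variable {D : ∀ i, DiracStructure (I i) (M i)}

/-- When the `i`-th coordinate stays at the centre of its chart, the `i`-th component of the
pullback is the identity, so the subspace does not move with the other coordinates. -/
theorem prodComponent_chartSection_mem
    {e : ∀ p : (∀ i, M i), GenTangent (ModelWithCorners.pi I) p}
    (he : ∀ p, e p ∈ prodDirac D p) {p : ∀ i, M i} {i : ι} {y : ∀ i, E i}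
    (hy : ∀ j, y j ∈ (extChartAt (I j) (p j)).target) (hi : y i = extChartAt (I i) (p i) (p i)) :
    prodComponent E i (chartSection (ModelWithCorners.pi I) e p y) ∈
      (D i).modelFiber (p i) := by
  have h := mem_prodDirac.1 (he ((extChartAt (ModelWithCorners.pi I) p).symm y)) i
  rw [extChartAt_pi_symm_apply, hi, extChartAt_to_inv] at h
  rwa [chartSection_eq, prodComponent_chartPullback hy, hi, chartPullback_self]

variable [∀ i, FiniteDimensional ℝ (E i)]

/-- The derivative of a section of the product, up to the product Dirac structure, sees only the
slices through the base point. -/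
theorem prodComponent_fderiv_chartSection_sub_mem
    {e : ∀ p : (∀ i, M i), GenTangent (ModelWithCorners.pi I) p}
    (hs : ∀ p, SmoothSectionAt (ModelWithCorners.pi I) e p)
    (he : ∀ p, e p ∈ prodDirac D p) (p : ∀ i, M i) (i : ι) (v : ∀ i, E i) :
    prodComponent E i (fderiv ℝ (chartSection (ModelWithCorners.pi I) e p)
        (extChartAt (ModelWithCorners.pi I) p p) v) -
      fderiv ℝ (chartSection (I i) (sliceSection e p i) (p i)) (extChartAt (I i) (p i) (p i)) (v i) ∈
        (D i).modelFiber (p i) := by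
  set x := extChartAt (ModelWithCorners.pi I) p p with hx
  have hd := (differentiableAt_chartSection (hs p)).hasFDerivAt
  have htarget : ∀ᶠ y in 𝓝 x, ∀ j, y j ∈ (extChartAt (I j) (p j)).target := by
    filter_upwards [target_nhds (I := ModelWithCorners.pi I) p] with y hy
    exact (mem_extChartAt_pi_target I).1 hy
  -- The slice in the chart is a coordinate slice, so its derivative is the partial derivative in
  -- the `i`-th direction.
  have h1 : fderiv ℝ (chartSection (I i) (sliceSection e p i) (p i))
      (extChartAt (I i) (p i) (p i)) (v i) =
      prodComponent E i (fderiv ℝ (chartSection (ModelWithCorners.pi I) e p) x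
        (Pi.single i (v i))) := by
    have h2 : HasFDerivAt (fun z : E i => Function.update x i z)
        (ContinuousLinearMap.single ℝ E i) (x i) :=
      (hasFDerivAt_update x (x i)).congr_fderiv (by
        ext u j
        by_cases h : j = i
        · subst h
          simp
        · simp [h])
    have h3 : HasFDerivAt (chartSection (ModelWithCorners.pi I) e p)
        (fderiv ℝ (chartSection (ModelWithCorners.pi I) e p) x) (Function.update x i (x i)) := by
      rwa [Function.update_eq_self]
    have h4 := ((prodComponent E i).hasFDerivAt.comp (x i) (h3.comp (x i) h2)).congr_of_eventuallyEq
      (f₁ := chartSection (I i) (sliceSection e p i) (p i)) (by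
        filter_upwards [target_nhds (I := I i) (p i)] with z hz
        exact chartSection_sliceSection e p i hz)
    exact DFunLike.congr_fun h4.fderiv (v i)
  rw [h1, ← map_sub, ← map_sub]
  -- The remaining direction has zero `i`-th coordinate. Along the line through `x` in this
  -- direction the component stays in the fixed fibre, hence so does its derivative.
  set w := v - Pi.single i (v i) with hw
  have h2 : HasDerivAt (fun t : ℝ => x + t • w) w 0 := by
    simpa using ((hasDerivAt_id (0 : ℝ)).smul_const w).const_add x
  have h0 : x + (0 : ℝ) • w = x := by simp
  have h3 : HasFDerivAt (chartSection (ModelWithCorners.pi I) e p)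
      (fderiv ℝ (chartSection (ModelWithCorners.pi I) e p) x) (x + (0 : ℝ) • w) := by
    rwa [h0]
  have h4 := (prodComponent E i).hasFDerivAt.comp_hasDerivAt (0 : ℝ)
    (h3.comp_hasDerivAt (0 : ℝ) h2)
  refine h4.mem_submodule _ ?_
  have hc : Filter.Tendsto (fun t : ℝ => x + t • w) (𝓝 0) (𝓝 x) := by
    simpa [h0] using h2.continuousAt.tendsto
  filter_upwards [hc.eventually htarget] with t ht
  refine prodComponent_chartSection_mem he ht ?_
  show x i + t • (v i - (Pi.single i (v i) : ∀ i, E i) i) = x i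
  rw [Pi.single_eq_same, sub_self, smul_zero, add_zero]

theorem dorfman_mem_prodDirac
    {e e' : ∀ p : (∀ i, M i), GenTangent (ModelWithCorners.pi I) p}
    (hs : ∀ p, SmoothSectionAt (ModelWithCorners.pi I) e p) (he : ∀ p, e p ∈ prodDirac D p)
    (hs' : ∀ p, SmoothSectionAt (ModelWithCorners.pi I) e' p) (he' : ∀ p, e' p ∈ prodDirac D p)
    (p : ∀ i, M i) : dorfman (ModelWithCorners.pi I) e e' p ∈ prodDirac D p := by
  refine mem_of_maximal_isotropic (maximal_isIsotropic_prodDirac D p) fun f hf => ?_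
  refine div_eq_zero_iff.2 (Or.inl ?_)
  show modelPairing (modelValue (ModelWithCorners.pi I) (dorfman (ModelWithCorners.pi I) e e' p))
    (modelValue (ModelWithCorners.pi I) f) = 0
  have hslice : ∀ (e : ∀ p : (∀ i, M i), GenTangent (ModelWithCorners.pi I) p) (i : ι),
      modelValue (I i) (sliceSection e p i (p i)) =
        prodComponent E i (modelValue (ModelWithCorners.pi I) (e p)) := fun e i =>
    congrArg (fun r => prodComponent E i (show (∀ i, E i) × ((∀ i, E i) →L[ℝ] ℝ) from e r))
      (Function.update_eq_self i p)
  -- The error between the full derivative and the slice derivative lies in the isotropic fibre `L i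
  -- (p i)`, so pairing with an element of that fibre does not see it.
  have hpair : ∀ {e : ∀ p : (∀ i, M i), GenTangent (ModelWithCorners.pi I) p}
      (_ : ∀ p, SmoothSectionAt (ModelWithCorners.pi I) e p) (_ : ∀ p, e p ∈ prodDirac D p)
      (v : ∀ i, E i) {b : GenTangent (ModelWithCorners.pi I) p} (_ : b ∈ prodDirac D p),
      modelPairing (fderiv ℝ (chartSection (ModelWithCorners.pi I) e p)
        (extChartAt (ModelWithCorners.pi I) p p) v) (modelValue (ModelWithCorners.pi I) b) =
      ∑ i, modelPairing (fderiv ℝ (chartSection (I i) (sliceSection e p i) (p i))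
        (extChartAt (I i) (p i) (p i)) (v i))
          (prodComponent E i (modelValue (ModelWithCorners.pi I) b)) := by
    intro e hs he v b hb
    rw [modelPairing_eq_sum]
    refine Finset.sum_congr rfl fun i _ => sub_eq_zero.1 ?_
    rw [← modelPairing_sub_left]
    exact (D i).modelPairing_eq_zero (prodComponent_fderiv_chartSection_sub_mem hs he p i v)
      (mem_prodDirac.1 hb i)
  rw [modelPairing_dorfman (hs p) (hs' p), hpair hs' he' _ hf, hpair hs he _ hf,
    hpair hs he _ (he' p), ← Finset.sum_sub_distrib, ← Finset.sum_add_distrib]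
  refine Finset.sum_eq_zero fun i _ => ?_
  -- The `i`-th summand is the bracket formula for the slices; its left side vanishes by
  -- involutivity and isotropy of `L i`.
  have h1 := modelPairing_dorfman (smoothSectionAt_sliceSection hs p i (p i))
    (smoothSectionAt_sliceSection hs' p i (p i))
    (prodComponent E i (modelValue (ModelWithCorners.pi I) f))
  have h2 : modelValue (I i) (dorfman (I i) (sliceSection e p i) (sliceSection e' p i) (p i)) ∈
      (D i).modelFiber (p i) := (D i).involutive _ _ (smoothSectionAt_sliceSection hs p i) (sliceSection_mem he p i)
    (smoothSectionAt_sliceSection hs' p i) (sliceSection_mem he' p i) (p i)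
  rw [(D i).modelPairing_eq_zero h2 (mem_prodDirac.1 hf i), hslice, hslice] at h1
  exact h1.symm

variable (D) in
/-- The product of Dirac structures. -/
def DiracStructure.pi : DiracStructure (ModelWithCorners.pi I) (∀ i, M i) where
  L := prodDirac D
  maximal_isotropic := maximal_isIsotropic_prodDirac D
  exists_frame := exists_frame_prodDirac D
  involutive _ _ hs he hs' he' := dorfman_mem_prodDirac hs he hs' he'

end ProductDirac

/-! ### Momentum maps and their derivatives -/

section MomentumCalculus
variable {E : Type*} [NormedAddCommGroup E] [NormedSpace ℝ E] {H : Type*} [TopologicalSpace H]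
  {I : ModelWithCorners ℝ E H} {M : Type*} [TopologicalSpace M] [ChartedSpace H M]
  [IsManifold I ∞ M] {D : DiracStructure I M} {g : Type*} [AddCommGroup g] [Module ℝ g]
  [FiniteDimensional ℝ g]

theorem toDual_momentumMap (φ : g →ₗ[ℝ] Adm D) (x : M) (u : g) :
    LieDual.toDual g (momentumMap φ x) u = (φ u).1 x := rfl

/-- Reduces smoothness of the momentum map to that of finitely many admissible functions. -/
theorem momentumMap_eq_sum (φ : g →ₗ[ℝ] Adm D) (x : M) :
    momentumMap φ x = ∑ a, (φ (Module.finBasis ℝ g a)).1 x •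
      (LieDual.toDual g).symm ((Module.finBasis ℝ g).coord a) := by
  refine (LieDual.toDual g).injective ((Module.finBasis ℝ g).ext fun c => ?_)
  simp [toDual_momentumMap, Finsupp.single_apply]

theorem contMDiff_momentumMap (φ : g →ₗ[ℝ] Adm D) :
    ContMDiff I 𝓘(ℝ, LieDual g) ∞ (momentumMap φ) := by
  have h : momentumMap φ = fun x => ∑ a, (φ (Module.finBasis ℝ g a)).1 x •
      (LieDual.toDual g).symm ((Module.finBasis ℝ g).coord a) := funext (momentumMap_eq_sum φ)
  rw [h]
  exact contMDiff_finsetSum fun a _ => (φ _).1.contMDiff.smul contMDiff_const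

variable (g) in
/-- The evaluation at an element of `g`, on the dual of `g`. -/
def evalDual (u : g) : LieDual g →L[ℝ] ℝ :=
  LinearMap.toContinuousLinearMap
    (Module.Dual.eval ℝ g u ∘ₗ (LieDual.toDual g).toLinearMap)

end MomentumCalculus

theorem sum_sum_smul_single_apply {ι : Type*} [Fintype ι] [DecidableEq ι] {E : ι → Type*}
    [∀ i, AddCommGroup (E i)] [∀ i, Module ℝ (E i)] {r : ι → Type*} [∀ i, Fintype (r i)]
    (c : ∀ i, r i → ℝ) (v : ∀ i, r i → E i) (i : ι) :
    (∑ j, ∑ a, c j a • (Pi.single j (v j a) : ∀ i, E i)) i = ∑ a, c i a • v i a := by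
  rw [Finset.sum_apply, Finset.sum_eq_single i]
  · simp [Finset.sum_apply]
  · intro j _ hj
    simp [Finset.sum_apply, hj.symm]
  · simp

/-! ### The pullback by the product of the momentum maps -/

section ProductMomentum
variable {ι : Type*} [Fintype ι] {E : ι → Type*} [∀ i, NormedAddCommGroup (E i)]
  [∀ i, NormedSpace ℝ (E i)] {H : ι → Type*} [∀ i, TopologicalSpace (H i)]
  {I : ∀ i, ModelWithCorners ℝ (E i) (H i)}
  {M : ι → Type*} [∀ i, TopologicalSpace (M i)] [∀ i, ChartedSpace (H i) (M i)]
  [∀ i, IsManifold (I i) ∞ (M i)] {D : ∀ i, DiracStructure (I i) (M i)}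
  {g : ι → Type*} [∀ i, LieRing (g i)] [∀ i, LieAlgebra ℝ (g i)] [∀ i, FiniteDimensional ℝ (g i)]
  (φ : ∀ i, g i →ₗ[ℝ] Adm (D i))

/-- The product of the momentum maps. -/
def prodMomentum (p : ∀ i, M i) : ∀ i, LieDual (g i) := fun i => momentumMap (φ i) (p i)

theorem contMDiff_prodMomentum :
    ContMDiff (ModelWithCorners.pi I) 𝓘(ℝ, ∀ i, LieDual (g i)) ∞ (prodMomentum φ) :=
  contMDiff_pi_space.2 fun i => (contMDiff_momentumMap (φ i)).comp (contMDiff_eval I i)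

/-- The derivative of the product of the momentum maps, as a map of model spaces. -/
def prodMomentumDeriv (p : ∀ i, M i) : (∀ i, E i) →L[ℝ] ∀ i, LieDual (g i) :=
  mfderiv (ModelWithCorners.pi I) 𝓘(ℝ, ∀ i, LieDual (g i)) (prodMomentum φ) p

theorem mvfderiv_comp_prodMomentum {F : (∀ i, LieDual (g i)) → ℝ} (p : ∀ i, M i)
    (hF : DifferentiableAt ℝ F (prodMomentum φ p)) (v : ∀ i, E i) :
    mvfderiv (ModelWithCorners.pi I) (fun q => F (prodMomentum φ q)) p v =
      fderiv ℝ F (prodMomentum φ p) (prodMomentumDeriv φ p v) := by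
  have h1 := ((contMDiff_prodMomentum φ p).mdifferentiableAt (by simp)).hasMFDerivAt
  have h2 := hF.hasFDerivAt.hasMFDerivAt.comp p h1
  exact DFunLike.congr_fun h2.mfderiv v

theorem toDual_prodMomentumDeriv (p : ∀ i, M i) (v : ∀ i, E i) (i : ι) (u : g i) :
    LieDual.toDual (g i) (prodMomentumDeriv φ p v i) u =
      mvfderiv (I i) (φ i u).1 (p i) (v i) := by
  -- Composed with the product of the momentum maps, the linear function `A` is `p ↦ φ i u (p i)`;
  -- the chain rule then gives its differential in two ways.
  let A : (∀ i, LieDual (g i)) →L[ℝ] ℝ :=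
    evalDual (g i) u ∘L ContinuousLinearMap.proj (R := ℝ) (φ := fun i => LieDual (g i)) i
  have h1 := mvfderiv_comp_prodMomentum φ (F := A) p A.differentiableAt v
  rw [A.fderiv] at h1
  refine h1.symm.trans ?_
  have h2 := ((md_smooth (φ i u).1 (p i)).hasMFDerivAt).comp p (hasMFDerivAt_eval I i p)
  exact DFunLike.congr_fun h2.mfderiv v

variable [DecidableEq ι]

theorem mvfderiv_pullback (F : C^∞⟮𝓘(ℝ, ∀ i, LieDual (g i)), ∀ i, LieDual (g i); 𝓘(ℝ, ℝ), ℝ⟯)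
    (p : ∀ i, M i) (v : ∀ i, E i) :
    mvfderiv (ModelWithCorners.pi I) (fun q => F (prodMomentum φ q)) p v =
      ∑ i, mvfderiv (I i) (φ i (covectorPart g i (fderiv ℝ F (prodMomentum φ p)))).1 (p i) (v i) := by
  rw [mvfderiv_comp_prodMomentum φ p (fd_smooth F _), ← sum_covectorPart]
  simp only [toDual_prodMomentumDeriv]

/-- The coordinate with index `a` of the part in `g i` of the differential of `F` at the value of the
momentum map. -/
def pullbackCoeff (F : C^∞⟮𝓘(ℝ, ∀ i, LieDual (g i)), ∀ i, LieDual (g i); 𝓘(ℝ, ℝ), ℝ⟯) (i : ι)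
    (a : Fin (Module.finrank ℝ (g i))) (p : ∀ i, M i) : ℝ :=
  (Module.finBasis ℝ (g i)).coord a (covectorPart g i (fderiv ℝ F (prodMomentum φ p)))

theorem contMDiff_pullbackCoeff
    (F : C^∞⟮𝓘(ℝ, ∀ i, LieDual (g i)), ∀ i, LieDual (g i); 𝓘(ℝ, ℝ), ℝ⟯) (i : ι)
    (a : Fin (Module.finrank ℝ (g i))) :
    ContMDiff (ModelWithCorners.pi I) 𝓘(ℝ, ℝ) ∞ (pullbackCoeff φ F i a) := by
  have h1 : ContDiff ℝ ∞ (fderiv ℝ F) := F.contMDiff.contDiff.fderiv_right (by simp)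
  exact (LinearMap.toContinuousLinearMap
    ((Module.finBasis ℝ (g i)).coord a ∘ₗ covectorPart g i)).contMDiff.comp
      (h1.contMDiff.comp (contMDiff_prodMomentum φ))

theorem sum_pullbackCoeff
    (F : C^∞⟮𝓘(ℝ, ∀ i, LieDual (g i)), ∀ i, LieDual (g i); 𝓘(ℝ, ℝ), ℝ⟯) (i : ι) (p : ∀ i, M i) :
    ∑ a, pullbackCoeff φ F i a p • Module.finBasis ℝ (g i) a =
      covectorPart g i (fderiv ℝ F (prodMomentum φ p)) :=
  (Module.finBasis ℝ (g i)).sum_repr _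

/-- A vector field of an admissible function, with the differential of the function. -/
def hamSection {E : Type*} [NormedAddCommGroup E] [NormedSpace ℝ E] {H : Type*}
    [TopologicalSpace H] {I : ModelWithCorners ℝ E H} {M : Type*} [TopologicalSpace M]
    [ChartedSpace H M] [IsManifold I ∞ M] {D : DiracStructure I M} (f : Adm D) (x : M) :
    GenTangent I x :=
  (Adm.hamVF f x, mvfderiv I f.1 x)

/-- A Hamiltonian vector field of the pullback of `F` by the product of the momentum maps. -/
def pullbackVF (F : C^∞⟮𝓘(ℝ, ∀ i, LieDual (g i)), ∀ i, LieDual (g i); 𝓘(ℝ, ℝ), ℝ⟯) (p : ∀ i, M i) :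
    TangentSpace (ModelWithCorners.pi I) p :=
  ∑ i, ∑ a, pullbackCoeff φ F i a p •
    (liftSection i (hamSection (φ i (Module.finBasis ℝ (g i) a))) p).1

theorem pullbackVF_apply
    (F : C^∞⟮𝓘(ℝ, ∀ i, LieDual (g i)), ∀ i, LieDual (g i); 𝓘(ℝ, ℝ), ℝ⟯) (p : ∀ i, M i) (i : ι) :
    (pullbackVF φ F p : ∀ i, E i) i = ∑ a, pullbackCoeff φ F i a p •
      (Adm.hamVF (φ i (Module.finBasis ℝ (g i) a)) (p i) : E i) := by
  exact sum_sum_smul_single_apply (E := E) (pullbackCoeff φ F · · p)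
    (fun j a => Adm.hamVF (φ j (Module.finBasis ℝ (g j) a)) (p j)) i

variable [∀ i, (I i).Boundaryless]

theorem smoothVFAt_pullbackVF
    (F : C^∞⟮𝓘(ℝ, ∀ i, LieDual (g i)), ∀ i, LieDual (g i); 𝓘(ℝ, ℝ), ℝ⟯) (p : ∀ i, M i) :
    SmoothVFAt (ModelWithCorners.pi I) (pullbackVF φ F) p := by
  refine ContMDiffAt.sum_section fun i _ => ContMDiffAt.sum_section fun a _ => ?_
  refine vf_smul (contMDiff_pullbackCoeff φ F i a p) (smoothSectionAt_liftSection ?_).1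
  exact ⟨(Adm.hamVF_spec _).1 _, oneFormAt_mvfderiv ((φ i _).1.contMDiff _)⟩

variable [∀ i, FiniteDimensional ℝ (E i)]

/-- In each fibre, the `i`-th component of `(X, d(F ∘ J))` is a linear combination of Hamiltonian
pairs of the `φ i (b a)`, all in `L i`. The coefficients vary with `p`, but membership is fibrewise
and does not involve their derivatives. -/
theorem isHamiltonian_pullbackVF
    (F : C^∞⟮𝓘(ℝ, ∀ i, LieDual (g i)), ∀ i, LieDual (g i); 𝓘(ℝ, ℝ), ℝ⟯) :
    IsHamiltonian (DiracStructure.pi D) (fun p => F (prodMomentum φ p)) (pullbackVF φ F) := by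
  refine ⟨smoothVFAt_pullbackVF φ F, fun p => mem_prodDirac.2 fun i => ?_⟩
  have h : prodComponent E i (modelValue (ModelWithCorners.pi I) (pullbackVF φ F p,
      mvfderiv (ModelWithCorners.pi I) (fun p => F (prodMomentum φ p)) p)) =
      ∑ a, pullbackCoeff φ F i a p •
        modelValue (I i) (hamSection (φ i (Module.finBasis ℝ (g i) a)) (p i)) := by
    refine Prod.ext ?_ ?_
    · rw [Prod.fst_sum]
      exact pullbackVF_apply φ F p i
    · rw [Prod.snd_sum]
      ext w
      have h1 := mvfderiv_comp_prodMomentum φ p (fd_smooth F _) (Pi.single i w)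
      rw [prodComponent_snd_apply]
      refine h1.trans ?_
      rw [← sum_covectorPart, Finset.sum_eq_single i, ← sum_pullbackCoeff, map_sum, sum_apply]
      · refine Finset.sum_congr rfl fun a _ => ?_
        rw [map_smul, toDual_prodMomentumDeriv, Pi.single_eq_same]
        rfl
      · intro j _ hj
        rw [toDual_prodMomentumDeriv, Pi.single_eq_of_ne hj]
        exact map_zero _
      · simp
  rw [h]
  exact Submodule.sum_mem _ fun a _ => Submodule.smul_mem _ _ ((Adm.hamVF_spec _).2 (p i))

/-- The pullback of functions by the product of the momentum maps. -/
def momentumPullback :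
    C^∞⟮𝓘(ℝ, ∀ i, LieDual (g i)), ∀ i, LieDual (g i); 𝓘(ℝ, ℝ), ℝ⟯ →ₐ[ℝ]
      Adm (DiracStructure.pi D) where
  toFun F := ⟨F.comp ⟨prodMomentum φ, contMDiff_prodMomentum φ⟩, _, isHamiltonian_pullbackVF φ F⟩
  map_one' := rfl
  map_mul' _ _ := rfl
  map_zero' := rfl
  map_add' _ _ := rfl
  commutes' _ := rfl

theorem momentumPullback_apply
    (F : C^∞⟮𝓘(ℝ, ∀ i, LieDual (g i)), ∀ i, LieDual (g i); 𝓘(ℝ, ℝ), ℝ⟯) (p : ∀ i, M i) :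
    (momentumPullback φ F).1 p = F (prodMomentum φ p) := rfl

/-- The bracket does not depend on the Hamiltonian field, so `pullbackVF` may compute it. Only `d_i
F` is expanded in the basis, since that is how this field is built; `d_i G` stays whole as `w`. -/
theorem momentumPullback_poissonBracket
    (hφ : ∀ i, ∀ v w : g i, φ i ⁅v, w⁆ = PoissonAlgebra.poissonBracket (φ i v) (φ i w))
    (F G : C^∞⟮𝓘(ℝ, ∀ i, LieDual (g i)), ∀ i, LieDual (g i); 𝓘(ℝ, ℝ), ℝ⟯) :
    momentumPullback φ (PoissonAlgebra.poissonBracket F G) =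
      PoissonAlgebra.poissonBracket (momentumPullback φ F) (momentumPullback φ G) := by
  ext p
  rw [momentumPullback_apply, kks_apply]
  refine Eq.trans ?_ (Adm.pb_apply (momentumPullback φ F) (momentumPullback φ G)
    (isHamiltonian_pullbackVF φ F) p).symm
  refine Eq.trans ?_ (congrArg Neg.neg (mvfderiv_pullback φ G p (pullbackVF φ F p))).symm
  rw [← Finset.sum_neg_distrib]
  refine Finset.sum_congr rfl fun i _ => ?_
  set w := covectorPart g i (fderiv ℝ G (prodMomentum φ p))
  rw [pullbackVF_apply, ← sum_pullbackCoeff, sum_lie, map_sum]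
  have h := map_sum (mvfderiv (I i) (φ i w).1 (p i)) (fun a => pullbackCoeff φ F i a p •
      (Adm.hamVF (φ i (Module.finBasis ℝ (g i) a)) (p i))) Finset.univ
  refine Eq.trans ?_ (congrArg Neg.neg h).symm
  rw [← Finset.sum_neg_distrib]
  refine Finset.sum_congr rfl fun a _ => ?_
  rw [smul_lie, map_smul, map_smul]
  have h2 : LieDual.toDual (g i) (prodMomentum φ p i) ⁅Module.finBasis ℝ (g i) a, w⁆ =
      - mvfderiv (I i) (φ i w).1 (p i) (Adm.hamVF (φ i (Module.finBasis ℝ (g i) a)) (p i)) := by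
    -- The momentum map evaluated on a Lie bracket is the value of `φ i` on it, and the morphism
    -- property turns this into a Poisson bracket of admissible functions.
    show (φ i ⁅Module.finBasis ℝ (g i) a, w⁆).1 (p i) = _
    rw [hφ]
    rfl
  rw [h2]
  exact mul_neg _ _

end ProductMomentum

end

theorem mainTheorem5 {k : ℕ}
    {E : Fin k → Type*} [∀ i, NormedAddCommGroup (E i)] [∀ i, NormedSpace ℝ (E i)]
    [∀ i, FiniteDimensional ℝ (E i)]
    {H : Fin k → Type*} [∀ i, TopologicalSpace (H i)]
    (I : ∀ i, ModelWithCorners ℝ (E i) (H i)) [∀ i, (I i).Boundaryless]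
    (M : Fin k → Type*) [∀ i, TopologicalSpace (M i)] [∀ i, ChartedSpace (H i) (M i)]
    [∀ i, IsManifold (I i) ∞ (M i)] [∀ i, T2Space (M i)] [∀ i, SecondCountableTopology (M i)]
    (L : ∀ i, DiracStructure (I i) (M i))
    (g : Fin k → Type*) [∀ i, LieRing (g i)] [∀ i, LieAlgebra ℝ (g i)]
    [∀ i, FiniteDimensional ℝ (g i)]
    (φ : ∀ i, g i →ₗ[ℝ] Adm (L i))
    (hφ : ∀ i, ∀ v w : g i, φ i ⁅v, w⁆ = PoissonAlgebra.poissonBracket (φ i v) (φ i w)) :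
    ∃ D : DiracStructure (ModelWithCorners.pi I) (∀ i, M i), D.L = prodDirac L ∧
      ∃ Ψ : PoissonHom
          C^∞⟮𝓘(ℝ, ∀ i, LieDual (g i)), ∀ i, LieDual (g i); 𝓘(ℝ, ℝ), ℝ⟯ (Adm D),
        ∀ (F : C^∞⟮𝓘(ℝ, ∀ i, LieDual (g i)), ∀ i, LieDual (g i); 𝓘(ℝ, ℝ), ℝ⟯) (p : ∀ i, M i),
          (Ψ.toAlgHom F).1 p = F fun i => momentumMap (φ i) (p i) := by
  refine ⟨DiracStructure.pi L, rfl, ⟨momentumPullback φ, ?_⟩, fun F p => rfl⟩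
  exact momentumPullback_poissonBracket φ hφ
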